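/- **Setting.** Let $d\ge 0$ be an integer (the case of interest being $d\ge1$), $\mathbb T^d=\mathbb R^d/\mathbb Z^d$ with Lebesgue measure, $\nu>0$, $T>0$, and let $\mathcal P$ be the set of probability densities on $\mathbb T^d$. Let $H$ assign to every $m\in C(\mathbb T^d)$ a real function $(x,p)\mapsto H[m](x,p)$ on $\mathbb T^d\times\mathbb R^d$. As a standing assumption, for all $m\in C(\mathbb T^d)$, $x\in\mathbb T^d$, $p\in\mathbb R^d$ the differential of $m\mapsto H[m](x,p)$ is represented by a function $\frac{\partial H}{\partial m}[m](x,p)\in L^\infty(\mathbb T^d)$, that is, $$D_mH[m](x,p)\,\mu=\int_{\mathbb T^d}\frac{\partial H}{\partial m}[m](x,p)(y)\,\mu(y)\,dy\qquad\text{for all }\mu\in C(\mathbb T^d),$$ and $(x,p)\mapsto\frac{\partial H}{\partial m}[m](x,p)$ is continuous from $\mathbb T^d\times\mathbb R^d$ to $L^\infty(\mathbb T^d)$. Let $u_T$ be a smooth function on $\mathbb T^d$ (the terminal cost, which does not depend on $m$) and let $m_0$ be a smooth, everywhere positive probability density on $\mathbb T^d$ (assumption $(H_0)$). Consider the system $$\partial_t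 u+\nu\Delta u+H[m(t,\cdot)](x,\nabla u(t,x))+\int_{\mathbb T^d}\frac{\partial H}{\partial m}[m(t,\cdot)](\xi,\nabla u(t,\xi))(x)\,m(t,\xi)\,d\xi=0,\tag{6}$$ $$\partial_t m-\nu\Delta m+\operatorname{div}\Bigl(m(t,\cdot)\frac{\partial H}{\partial p}[m(t,\cdot)](\cdot,\nabla u(t,\cdot))\Bigr)(x)=0,\tag{7}$$ $$m(0,x)=m_0(x),\qquad u(T,x)=u_T(x).\tag{8}$$ A classical solution of (6)–(8) is a pair $(u,m)$ of real functions, continuous on $[0,T]\times\mathbb T^d$, for which $\partial_t$ and the derivatives in $x$ of order at most two exist and are continuous on $(0,T)\times\mathbb T^d$, and which satisfies (6) and (7) for $t\in(0,T)$ and satisfies (8). The integral in (6) is an $L^\infty(\mathbb T^d)$-valued integral, and (6) is understood, for each $t$, as an identity in $L^\infty(\mathbb T^d)$ (for almost every $x$); (7) holds for every $x$. For $m\in C(\mathbb T^d)$ and $p\in C(\mathbb T^d;\mathbb R^d)$ put $$\mathcal H[m,p]=\int_{\mathbb T^d}m(x)\,H[m](x,p(x))\,dx,$$ and let $D^2_{m,m}\mathcal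 H[m,p]$, a bilinear form on $C(\mathbb T^d)$, be its second Fréchet derivative with respect to $m$. **Theorem.** Assume $(H_0)$ and that $(m,x,p)\mapsto H[m](x,p)$ is $C^2$ on $C(\mathbb T^d)\times\mathbb T^d\times\mathbb R^d$. Suppose that 1. for all $m\in C(\mathbb T^d)\cap\mathcal P$ and all $p\in C(\mathbb T^d;\mathbb R^d)$, the quadratic form $\mu\mapsto D^2_{m,m}\mathcal H[m,p](\mu,\mu)$ is positive definite on $C(\mathbb T^d)$, i.e. $D^2_{m,m}\mathcal H[m,p](\mu,\mu)>0$ for every $\mu\ne0$; 2. for all $m\in C(\mathbb T^d)\cap\mathcal P$ and all $x\in\mathbb T^d$, the function $p\mapsto H[m](x,p)$ is strictly concave on $\mathbb R^d$. Then (6)–(8) has at most one classical solution: if $(u,m)$ and $(\tilde u,\tilde m)$ are classical solutions of (6)–(8), then $u=\tilde u$ and $m=\tilde m$ on $[0,T]\times\mathbb T^d$. -/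

import Mathlib

open MeasureTheory Set
open scoped ENNReal ContDiff

noncomputable section

namespace MFTC

/-- The `d`-dimensional unit torus `ℝ^d / ℤ^d`; its `volume` is the Lebesgue (Haar) measure, of total
mass `1`. -/
abbrev Torus (d : ℕ) : Type := UnitAddTorus (Fin d)

/-- `ℝ^d` with its Euclidean structure. -/
abbrev Vec (d : ℕ) : Type := EuclideanSpace ℝ (Fin d)

/-- The canonical projection `ℝ^d → ℝ^d / ℤ^d`. -/
def proj {d : ℕ} (v : Vec d) : Torus d := fun i => ((v i : ℝ) : UnitAddCircle)

/-- A function on the torus read in the chart centred at `x`: `v ↦ w (x + v)`, for `v ∈ ℝ^d`.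
Derivatives of `w` at `x` are derivatives of this function at `v = 0`. -/
def chart {d : ℕ} {F : Type*} (w : Torus d → F) (x : Torus d) : Vec d → F :=
  fun v => w (x + proj v)

/-- Spatial gradient `∇w (x)`. -/
def grad {d : ℕ} (w : Torus d → ℝ) (x : Torus d) : Vec d :=
  gradient (chart w x) 0

/-- Spatial Laplacian `Δw (x)`. -/
def lap {d : ℕ} (w : Torus d → ℝ) (x : Torus d) : ℝ :=
  Laplacian.laplacian (chart w x) 0

/-- Spatial divergence `div V (x) = ∑ i, ∂V_i/∂x_i (x)` of a vector field on the torus. -/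
def divergence {d : ℕ} (V : Torus d → Vec d) (x : Torus d) : ℝ :=
  ∑ i : Fin d, fderiv ℝ (chart (fun y => V y i) x) 0 (EuclideanSpace.single i 1)

/-- `m ∈ C(𝕋^d) ∩ 𝓟`: a continuous probability density. -/
structure IsProbDensity {d : ℕ} (m : C(Torus d, ℝ)) : Prop where
  nonneg : ∀ x, 0 ≤ m x
  integral_eq_one : ∫ x, m x = 1

/-- `k ∈ L^∞(𝕋^d)` represents the continuous linear form `φ` on `C(𝕋^d)`:
`φ(μ) = ∫ k(y) μ(y) dy`. -/
def Represents {d : ℕ} (k : Lp ℝ ∞ (volume : Measure (Torus d))) (φ : C(Torus d, ℝ) →L[ℝ] ℝ) :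
    Prop :=
  ∀ μ : C(Torus d, ℝ), φ μ = ∫ y, k y * μ y

/-- The representing function is unique, so the choice in `dHdm` is none. -/
theorem Represents.unique {d : ℕ} {k l : Lp ℝ ∞ (volume : Measure (Torus d))}
    {φ : C(Torus d, ℝ) →L[ℝ] ℝ} (hk : Represents k φ) (hl : Represents l φ) : k = l := by
  have hk2 : MemLp (fun x => k x) 2 (volume : Measure (Torus d)) :=
    (Lp.memLp k).mono_exponent le_top
  have hl2 : MemLp (fun x => l x) 2 (volume : Measure (Torus d)) :=
    (Lp.memLp l).mono_exponent le_top
  have key : hk2.toLp = hl2.toLp := by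
    refine (ContinuousMap.toLp_denseRange ℝ (volume : Measure (Torus d)) ℝ
      (p := 2) (by simp)).eq_of_inner_right (𝕜 := ℝ) ?_
    intro μ
    have a : ∀ (q : Torus d → ℝ) (hq : MemLp q 2 volume),
        inner ℝ (ContinuousMap.toLp 2 volume ℝ μ) hq.toLp = ∫ y, q y * μ y := by
      intro q hq
      rw [L2.inner_def]
      apply integral_congr_ae
      filter_upwards [hq.coeFn_toLp,
        ContinuousMap.coeFn_toLp (p := 2) (𝕜 := ℝ) volume μ] with x h1 h2
      rw [h1, h2]
      simp
    rw [a, a, ← hk, ← hl]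
  apply Lp.ext
  filter_upwards [hk2.coeFn_toLp, hl2.coeFn_toLp] with x h1 h2
  rw [← h1, ← h2, key]

/-- The differential at `m` of `m ↦ H[m](x, p)`, a continuous linear form on `C(𝕋^d)`. -/
def mDifferential {d : ℕ} (H : C(Torus d, ℝ) → Torus d → Vec d → ℝ)
    (m : C(Torus d, ℝ)) (x : Torus d) (p : Vec d) : C(Torus d, ℝ) →L[ℝ] ℝ :=
  fderiv ℝ (fun m' => H m' x p) m

open Classical in
/-- `∂H/∂m [m](x, p) ∈ L^∞(𝕋^d)`: the function `y ↦ ∂H/∂m [m](x, p)(y)` that represents the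
differential of `m ↦ H[m](x, p)` (with value `0` if there is none). -/
def dHdm {d : ℕ} (H : C(Torus d, ℝ) → Torus d → Vec d → ℝ)
    (m : C(Torus d, ℝ)) (x : Torus d) (p : Vec d) : Lp ℝ ∞ (volume : Measure (Torus d)) :=
  if h : ∃ k, Represents k (mDifferential H m x p) then h.choose else 0

theorem represents_dHdm {d : ℕ} {H : C(Torus d, ℝ) → Torus d → Vec d → ℝ}
    {m : C(Torus d, ℝ)} {x : Torus d} {p : Vec d}
    (h : ∃ k, Represents k (mDifferential H m x p)) :
    Represents (dHdm H m x p) (mDifferential H m x p) := by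
  unfold dHdm
  rw [dif_pos h]
  exact h.choose_spec

/-- `∂H/∂p [m](x, p) ∈ ℝ^d`. -/
def dHdp {d : ℕ} (H : C(Torus d, ℝ) → Torus d → Vec d → ℝ)
    (m : C(Torus d, ℝ)) (x : Torus d) (p : Vec d) : Vec d :=
  gradient (fun p' => H m x p') p

/-- The standing regularity of the Hamiltonian with respect to `m`: `∂H/∂m [m](x, p)` is a function
in `L^∞(𝕋^d)`, and it depends continuously on `(x, p)` in the norm of `L^∞(𝕋^d)`. -/
structure HasBoundedMDerivative {d : ℕ} (H : C(Torus d, ℝ) → Torus d → Vec d → ℝ) : Prop where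
  exists_density : ∀ m x p, ∃ k, Represents k (mDifferential H m x p)
  continuous_density : ∀ m, Continuous fun z : Torus d × Vec d => dHdm H m z.1 z.2

/-- The map `(m, x, p) ↦ H[m](x, p)` is `C²` on `C(𝕋^d) × 𝕋^d × ℝ^d`. -/
def IsC2Hamiltonian {d : ℕ} (H : C(Torus d, ℝ) → Torus d → Vec d → ℝ) : Prop :=
  ContDiff ℝ 2 fun z : C(Torus d, ℝ) × Vec d × Vec d => H z.1 (proj z.2.1) z.2.2

/-- The nonlocal term `G[m, q] = ∫ m(ξ) ∂H/∂m [m](ξ, q(ξ)) dξ ∈ L^∞(𝕋^d)`. -/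
def nonlocal {d : ℕ} (H : C(Torus d, ℝ) → Torus d → Vec d → ℝ)
    (m : C(Torus d, ℝ)) (q : Torus d → Vec d) : Lp ℝ ∞ (volume : Measure (Torus d)) :=
  ∫ ξ, m ξ • dHdm H m ξ (q ξ)

/-- The functional `𝓗[m, p] = ∫ m(x) H[m](x, p(x)) dx`. -/
def hamFunctional {d : ℕ} (H : C(Torus d, ℝ) → Torus d → Vec d → ℝ)
    (m : C(Torus d, ℝ)) (p : C(Torus d, Vec d)) : ℝ :=
  ∫ x, m x * H m x (p x)

/-- The second Fréchet derivative `D²_{m,m} 𝓗[m, p]`, a bilinear form on `C(𝕋^d)`. -/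
def hamHessian {d : ℕ} (H : C(Torus d, ℝ) → Torus d → Vec d → ℝ)
    (m : C(Torus d, ℝ)) (p : C(Torus d, Vec d)) :
    C(Torus d, ℝ) →L[ℝ] C(Torus d, ℝ) →L[ℝ] ℝ :=
  fderiv ℝ (fun m₁ => fderiv ℝ (fun m₂ => hamFunctional H m₂ p) m₁) m

/-- A function `w(t, x)`, continuous on `[0, T] × 𝕋^d`, that is once continuously differentiable
in `t` and twice in `x` on `(0, T) × 𝕋^d`. -/
structure IsC12 {d : ℕ} (T : ℝ) (w : ℝ → C(Torus d, ℝ)) : Prop where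
  continuousOn : ContinuousOn (fun z : ℝ × Torus d => w z.1 z.2) (Icc 0 T ×ˢ univ)
  time_differentiable : ∀ t ∈ Ioo 0 T, ∀ x, DifferentiableAt ℝ (fun s => w s x) t
  time_continuous : ContinuousOn
    (fun z : ℝ × Torus d => deriv (fun s => w s z.2) z.1) (Ioo 0 T ×ˢ univ)
  space_contDiff : ∀ t ∈ Ioo 0 T, ∀ x, ContDiff ℝ 2 (chart (w t) x)
  space_continuous : ∀ k : ℕ, k ≤ 2 → ContinuousOn
    (fun z : ℝ × Torus d => iteratedFDeriv ℝ k (chart (w z.1) z.2) 0) (Ioo 0 T ×ˢ univ)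

/-- `(u, m)` is a classical solution of the mean field type control system with Hamiltonian `H`,
viscosity `ν`, initial density `m₀` and terminal cost `uT` (independent of the density). The
Hamilton-Jacobi-Bellman equation involves the element `G[m(t), ∇u(t)]` of `L^∞(𝕋^d)`, so at each
time it is an identity between elements of `L^∞(𝕋^d)`. -/
structure IsClassicalSolution {d : ℕ} (ν T : ℝ) (H : C(Torus d, ℝ) → Torus d → Vec d → ℝ)
    (uT m₀ : C(Torus d, ℝ)) (u m : ℝ → C(Torus d, ℝ)) : Prop where
  regular_u : IsC12 T u
  regular_m : IsC12 T m
  hjb : ∀ t ∈ Ioo 0 T, ∀ᵐ x : Torus d,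
    deriv (fun s => u s x) t + ν * lap (u t) x + H (m t) x (grad (u t) x)
      + nonlocal H (m t) (grad (u t)) x = 0
  fokkerPlanck : ∀ t ∈ Ioo 0 T, ∀ x : Torus d,
    deriv (fun s => m s x) t - ν * lap (m t) x
      + divergence (fun y => m t y • dHdp H (m t) y (grad (u t) y)) x = 0
  initial : m 0 = m₀
  terminal : u T = uT

/-- Assumption on the data: the terminal cost is a smooth function `uT` of `x` only, and `m₀` is a
smooth positive probability density. -/
structure SmoothData {d : ℕ} (uT m₀ : C(Torus d, ℝ)) : Prop where
  smooth_uT : ∀ x, ContDiff ℝ ∞ (chart uT x)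
  smooth_m₀ : ∀ x, ContDiff ℝ ∞ (chart m₀ x)
  pos_m₀ : ∀ x, 0 < m₀ x
  integral_m₀ : ∫ x, m₀ x = 1

end MFTC

end

/-!
Let `(u, m)` and `(u', m')` be classical solutions, `p = ∇u`, `p' = ∇u'`. The proof is a duality
argument in the spirit of Lasry and Lions. Its first ingredient is that the zeroth order terms
`H[m](·, p) + G[m, p]` of the Hamilton-Jacobi-Bellman equation represent the derivative of
`𝓗[·, p]` at `m` (`fderiv_hamFunctional_apply`), while the flux `m ∂H/∂p` of the Fokker-Planck
equation represents the derivative of `𝓗[m, ·]` at `p`. Since the viscous terms cancel by Green's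
formula, the derivative of `t ↦ ∫ (u - u') (m - m')` is
`-(D_m 𝓗[m, p] - D_m 𝓗[m', p']) (m - m') + (D_p 𝓗[m, p] - D_p 𝓗[m', p']) (p - p')`
(`hasDerivAt_duality`).

On probability densities `𝓗` is strictly convex in `m`, by the assumption on its Hessian, and
concave in `p`, strictly so when `m` is positive. Adding four tangent inequalities shows that the
derivative above is nonpositive, and that it vanishes only if `m = m'` and `p = p'`
(`saddle_monotone`). As `∫ (u - u') (m - m')` is `0` at `t = 0` and at `t = T`, it is constant, so
`m = m'` and `∇u = ∇u'` (`density_and_grad_unique`). The Hamilton-Jacobi-Bellman equation then gives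
`∂_t u = ∂_t u'`, and `u = u'` follows from the terminal condition.

For this, `m(t)` has to be a positive probability density. Its mass is conserved because divergences
have integral `0`. For the positivity, the drift is controlled only on compact subintervals of
`(0, T)`: near `t = 0` the density is positive by continuity, since `m₀ > 0`, and from then on it
stays above an exponentially decreasing barrier (`IsClassicalSolution.barrier_lt`).

Derivatives on the torus are those of the charts `v ↦ w (x + v)`. The charts of `w` at different
points are translates of each other, so the chart of the derivative field is the derivative of the
chart (`chart_fderiv`), and integrals of derivatives vanish by translation invariance
(`integral_fderiv_chart`). Dependence on a point of the torus is continuous as soon as its lift to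
`ℝ^d` is, because the projection is an open quotient map.
-/

namespace MFTC

open Filter Topology

variable {d : ℕ} {F : Type*}

/-! ### Functions on the torus and their charts -/

theorem isOpenQuotientMap_proj : IsOpenQuotientMap (proj : Vec d → Torus d) := by
  have h1 : IsOpenQuotientMap (fun t : ℝ => (t : UnitAddCircle)) :=
    QuotientAddGroup.isOpenQuotientMap_mk
  have h2 : IsOpenQuotientMap (Pi.map fun (_ : Fin d) (t : ℝ) => (t : UnitAddCircle)) :=
    IsOpenQuotientMap.piMap fun _ => h1
  exact h2.comp (EuclideanSpace.equiv (Fin d) ℝ).toHomeomorph.isOpenQuotientMap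

theorem proj_surjective : Function.Surjective (proj : Vec d → Torus d) :=
  isOpenQuotientMap_proj.surjective

@[simp]
theorem proj_zero : proj (0 : Vec d) = 0 := by
  ext i; simp [proj]

@[simp]
theorem proj_add (v w : Vec d) : proj (v + w) = proj v + proj w := by
  ext i; simp [proj]

@[simp]
theorem chart_zero (w : Torus d → F) (x : Torus d) : chart w x 0 = w x := by
  simp [chart]

theorem chart_add_proj (w : Torus d → F) (x : Torus d) (v : Vec d) :
    chart w (x + proj v) = fun z => chart w x (v + z) := by
  funext z; simp [chart, add_assoc]

theorem continuous_of_chart [TopologicalSpace F] {w : Torus d → F} {x : Torus d}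
    (h : Continuous (chart w x)) : Continuous w := by
  have h2 : Continuous fun v => w (x + v) :=
    (isOpenQuotientMap_proj.isQuotientMap.continuous_iff).2 h
  simpa [Function.comp_def] using h2.comp (continuous_const_add (-x))

section Normed

variable [NormedAddCommGroup F] [NormedSpace ℝ F]

theorem fderiv_chart (w : Torus d → F) (x : Torus d) (v : Vec d) :
    fderiv ℝ (chart w x) v = fderiv ℝ (chart w (x + proj v)) 0 := by
  rw [chart_add_proj]
  simpa using (fderiv_comp_add_left (𝕜 := ℝ) (f := chart w x) (x := 0) v).symm

/-- The chart at a point of the derivative field is the derivative of the chart. -/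
theorem chart_fderiv (w : Torus d → F) (x : Torus d) :
    chart (fun y => fderiv ℝ (chart w y) 0) x = fderiv ℝ (chart w x) := by
  funext v
  rw [fderiv_chart, chart]

theorem continuous_fderiv_chart {w : Torus d → F} {x : Torus d}
    (h : ContDiff ℝ 1 (chart w x)) : Continuous fun y => fderiv ℝ (chart w y) 0 := by
  apply continuous_of_chart (x := x)
  rw [chart_fderiv]
  exact h.continuous_fderiv one_ne_zero

theorem continuous_of_contDiff_chart {n : WithTop ℕ∞} {w : Torus d → F} {x : Torus d}
    (h : ContDiff ℝ n (chart w x)) : Continuous w :=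
  continuous_of_chart h.continuous

end Normed

theorem chart_grad (w : Torus d → ℝ) (x : Torus d) :
    chart (grad w) x = fun v => (InnerProductSpace.toDual ℝ (Vec d)).symm
      (fderiv ℝ (chart w x) v) := by
  funext v
  rw [fderiv_chart, chart, grad, gradient]

theorem contDiff_chart_grad {w : Torus d → ℝ} {x : Torus d}
    (h : ContDiff ℝ 2 (chart w x)) : ContDiff ℝ 1 (chart (grad w) x) := by
  rw [chart_grad]
  exact (InnerProductSpace.toDual ℝ (Vec d)).symm.contDiff.comp
    (h.fderiv_right (m := 1) (by norm_num))

theorem continuous_grad {w : Torus d → ℝ} {x : Torus d}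
    (h : ContDiff ℝ 1 (chart w x)) : Continuous (grad w) := by
  apply continuous_of_chart (x := x)
  rw [chart_grad]
  exact (InnerProductSpace.toDual ℝ (Vec d)).symm.continuous.comp
    (h.continuous_fderiv one_ne_zero)

theorem inner_grad (w : Torus d → ℝ) (x : Torus d) (v : Vec d) :
    inner ℝ (grad w x) v = fderiv ℝ (chart w x) 0 v := by
  simp [grad, gradient]

theorem chart_grad_apply (w : Torus d → ℝ) (x : Torus d) (i : Fin d) :
    chart (fun y => grad w y i) x
      = fun v => fderiv ℝ (chart w x) v (EuclideanSpace.single i 1) := by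
  funext v
  rw [fderiv_chart, chart, ← inner_grad]
  simp [EuclideanSpace.inner_single_right]

/-- `Δw = div ∇w`. -/
theorem lap_eq_divergence_grad {w : Torus d → ℝ} {x : Torus d}
    (h : ContDiff ℝ 2 (chart w x)) : lap w x = divergence (grad w) x := by
  have hd : DifferentiableAt ℝ (fderiv ℝ (chart w x)) 0 :=
    (h.fderiv_right (m := 1) (by norm_num)).differentiable one_ne_zero 0
  rw [lap, InnerProductSpace.laplacian_eq_iteratedFDeriv_orthonormalBasis _
    (EuclideanSpace.basisFun (Fin d) ℝ), divergence]
  refine Finset.sum_congr rfl fun i _ => ?_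
  rw [chart_grad_apply, iteratedFDeriv_two_apply]
  rw [fderiv_clm_apply hd (differentiableAt_const _)]
  simp

theorem contDiff_chart_apply {n : WithTop ℕ∞} {V : Torus d → Vec d} {x : Torus d}
    (h : ContDiff ℝ n (chart V x)) (i : Fin d) : ContDiff ℝ n (chart (fun y => V y i) x) :=
  (EuclideanSpace.proj (𝕜 := ℝ) i).contDiff.comp h

theorem continuous_divergence {V : Torus d → Vec d} {x : Torus d}
    (h : ContDiff ℝ 1 (chart V x)) : Continuous (divergence V) := by
  unfold divergence
  refine continuous_finsetSum _ fun i _ => ?_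
  exact (continuous_fderiv_chart (contDiff_chart_apply h i)).clm_apply continuous_const

/-- `div (w V) = w div V + ∇w · V`. -/
theorem divergence_smul {w : Torus d → ℝ} {V : Torus d → Vec d} {x : Torus d}
    (hw : DifferentiableAt ℝ (chart w x) 0) (hV : DifferentiableAt ℝ (chart V x) 0) :
    divergence (fun y => w y • V y) x = w x * divergence V x + inner ℝ (grad w x) (V x) := by
  have key : ∀ i : Fin d, fderiv ℝ (chart (fun y => (w y • V y) i) x) 0
      (EuclideanSpace.single i 1) = w x * fderiv ℝ (chart (fun y => V y i) x) 0
        (EuclideanSpace.single i 1) + V x i * grad w x i := by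
    intro i
    have hVi : DifferentiableAt ℝ (chart (fun y => V y i) x) 0 :=
      (EuclideanSpace.proj (𝕜 := ℝ) i).differentiableAt.comp 0 hV
    have : chart (fun y => (w y • V y) i) x
        = fun v => chart w x v * chart (fun y => V y i) x v := by
      funext v; simp [chart]
    rw [this, fderiv_fun_mul hw hVi]
    have e := inner_grad w x (EuclideanSpace.single i 1)
    rw [EuclideanSpace.inner_single_right] at e
    simp at e
    simp [e]
  rw [divergence, Finset.sum_congr rfl fun i _ => key i, Finset.sum_add_distrib, ← Finset.mul_sum,
    divergence, PiLp.inner_apply]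
  simp

theorem grad_sub {f g : Torus d → ℝ} {x : Torus d} (hf : DifferentiableAt ℝ (chart f x) 0)
    (hg : DifferentiableAt ℝ (chart g x) 0) :
    grad (fun y => f y - g y) x = grad f x - grad g x := by
  have : chart (fun y => f y - g y) x = fun v => chart f x v - chart g x v := rfl
  rw [grad, grad, grad, gradient, gradient, gradient, this, fderiv_fun_sub hf hg, map_sub]

/-! ### Integration on the torus -/

theorem integrable_of_continuous [NormedAddCommGroup F] {f : Torus d → F} (hf : Continuous f) :
    Integrable f :=
  hf.integrable_of_hasCompactSupport (HasCompactSupport.of_compactSpace f)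

/-- The integral of a directional derivative vanishes: the integral of `w (· + s v)` does not
depend on `s`. -/
theorem integral_fderiv_chart {w : Torus d → ℝ} (hw : ∀ x, ContDiff ℝ 1 (chart w x)) (v : Vec d) :
    ∫ x, fderiv ℝ (chart w x) 0 v = 0 := by
  have hwc : Continuous w := continuous_of_contDiff_chart (hw 0)
  have hc : Continuous fun x => fderiv ℝ (chart w x) 0 v :=
    (continuous_fderiv_chart (hw 0)).clm_apply continuous_const
  obtain ⟨C, hC⟩ := isCompact_univ.exists_bound_of_continuousOn hc.continuousOn
  have hder : ∀ (x : Torus d) (s : ℝ), HasDerivAt (fun s : ℝ => w (x + proj (s • v)))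
      (fderiv ℝ (chart w (x + proj (s • v))) 0 v) s := by
    intro x s
    rw [← fderiv_chart]
    have h1 : HasFDerivAt (chart w x) (fderiv ℝ (chart w x) (s • v)) (s • v) :=
      ((hw x).differentiable one_ne_zero _).hasFDerivAt
    have h2 : HasDerivAt (fun s : ℝ => s • v) v s := by
      simpa using (hasDerivAt_id s).smul_const v
    exact h1.comp_hasDerivAt s h2
  have key := (hasDerivAt_integral_of_dominated_loc_of_deriv_le (μ := (volume : Measure (Torus d)))
    (F := fun (s : ℝ) x => w (x + proj (s • v)))
    (F' := fun (s : ℝ) x => fderiv ℝ (chart w (x + proj (s • v))) 0 v)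
    (bound := fun _ => C) (x₀ := 0) (s := univ) univ_mem
    (Eventually.of_forall fun s =>
      (hwc.comp (continuous_id.add continuous_const)).aestronglyMeasurable)
    (integrable_of_continuous (hwc.comp (continuous_id.add continuous_const)))
    (hc.comp (continuous_id.add continuous_const)).aestronglyMeasurable
    (Eventually.of_forall fun x s _ => hC _ (mem_univ _))
    (integrable_const C)
    (Eventually.of_forall fun x s _ => hder x s)).2
  have hconst : (fun s : ℝ => ∫ x : Torus d, w (x + proj (s • v))) = fun _ => ∫ x, w x := by
    funext s
    exact integral_add_right_eq_self w (proj (s • v))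
  rw [hconst] at key
  simpa using key.unique (hasDerivAt_const _ _)

/-- The divergence theorem on the torus. -/
theorem integral_divergence {V : Torus d → Vec d} (hV : ∀ x, ContDiff ℝ 1 (chart V x)) :
    ∫ x, divergence V x = 0 := by
  unfold divergence
  rw [integral_finsetSum]
  · exact Finset.sum_eq_zero fun i _ =>
      integral_fderiv_chart (fun x => contDiff_chart_apply (hV x) i) _
  · intro i _
    exact integrable_of_continuous
      ((continuous_fderiv_chart (contDiff_chart_apply (hV 0) i)).clm_apply continuous_const)

theorem contDiff_chart_smul {n : WithTop ℕ∞} {w : Torus d → ℝ} {V : Torus d → Vec d} {x : Torus d}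
    (hw : ContDiff ℝ n (chart w x)) (hV : ContDiff ℝ n (chart V x)) :
    ContDiff ℝ n (chart (fun y => w y • V y) x) :=
  hw.smul hV

/-- Integration by parts on the torus. -/
theorem integral_mul_divergence {w : Torus d → ℝ} {V : Torus d → Vec d}
    (hw : ∀ x, ContDiff ℝ 1 (chart w x)) (hV : ∀ x, ContDiff ℝ 1 (chart V x)) :
    ∫ x, w x * divergence V x = -∫ x, inner ℝ (grad w x) (V x) := by
  have h := integral_divergence fun x => contDiff_chart_smul (hw x) (hV x)
  simp_rw [fun x => divergence_smul ((hw x).differentiable one_ne_zero 0)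
    ((hV x).differentiable one_ne_zero 0)] at h
  rw [integral_add] at h
  · linarith
  · exact integrable_of_continuous
      ((continuous_of_contDiff_chart (hw 0)).mul (continuous_divergence (hV 0)))
  · exact integrable_of_continuous
      ((continuous_grad (hw 0)).inner (continuous_of_contDiff_chart (hV 0)))

theorem continuous_lap {w : Torus d → ℝ} (h : ∀ x, ContDiff ℝ 2 (chart w x)) :
    Continuous (lap w) := by
  have : lap w = divergence (grad w) := funext fun x => lap_eq_divergence_grad (h x)
  rw [this]
  exact continuous_divergence (contDiff_chart_grad (h 0))

/-- Green's formula on the torus. -/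
theorem integral_mul_lap {f g : Torus d → ℝ} (hf : ∀ x, ContDiff ℝ 1 (chart f x))
    (hg : ∀ x, ContDiff ℝ 2 (chart g x)) :
    ∫ x, f x * lap g x = -∫ x, inner ℝ (grad f x) (grad g x) := by
  simp_rw [fun x => lap_eq_divergence_grad (hg x)]
  exact integral_mul_divergence hf fun x => contDiff_chart_grad (hg x)

/-! ### Superposition operators on a compact space -/

section Superposition

variable {E X G : Type*} [NormedAddCommGroup E] [NormedSpace ℝ E] [TopologicalSpace X]
  [CompactSpace X] [NormedAddCommGroup G] [NormedSpace ℝ G]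

/-- A continuous family of continuous linear maps, as a continuous linear map into the space of
continuous functions. -/
noncomputable def familyCLM (K : C(X, E →L[ℝ] G)) : E →L[ℝ] C(X, G) :=
  LinearMap.mkContinuous
    { toFun := fun e => ⟨fun x => K x e, K.continuous.clm_apply continuous_const⟩
      map_add' := fun e f => by ext x; simp
      map_smul' := fun c e => by ext x; simp } ‖K‖ fun e => by
    rw [ContinuousMap.norm_le _ (by positivity)]
    intro x
    exact (K x).le_of_opNorm_le (K.norm_coe_le_norm x) e

@[simp]
theorem familyCLM_apply (K : C(X, E →L[ℝ] G)) (e : E) (x : X) : familyCLM K e x = K x e := rfl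

/-- If `Φ (e, x)` is differentiable in `e`, with a derivative `K (e, x)` that is jointly continuous,
then `e ↦ Φ (e, ·)` is differentiable into the continuous functions: by compactness, `K (·, x)` is
continuous uniformly in `x`, and the mean value inequality applies for every `x`. -/
theorem hasFDerivAt_superposition {Φ : E → C(X, G)} {K : E → C(X, E →L[ℝ] G)}
    (hK : Continuous fun z : E × X => K z.1 z.2)
    (h : ∀ e x, HasFDerivAt (fun e' => Φ e' x) (K e x) e) (e : E) :
    HasFDerivAt Φ (familyCLM (K e)) e := by
  have hKc : Continuous K := ContinuousMap.continuous_of_continuous_uncurry _ hK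
  rw [hasFDerivAt_iff_isLittleO, Asymptotics.isLittleO_iff]
  intro c hc
  obtain ⟨δ, hδ, hball⟩ := (Metric.continuousAt_iff (f := K) (a := e)).1 hKc.continuousAt c hc
  filter_upwards [Metric.ball_mem_nhds e hδ] with e' he'
  rw [ContinuousMap.norm_le _ (by positivity)]
  intro x
  have := (convex_ball e δ).norm_image_sub_le_of_norm_hasFDerivWithin_le'
    (f := fun e' => Φ e' x) (f' := fun e' => K e' x) (φ := K e x) (C := c)
    (fun y _ => (h y x).hasFDerivWithinAt)
    (fun y hy => by
      have h1 := hball hy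
      rw [← dist_eq_norm]
      exact (ContinuousMap.dist_apply_le_dist x).trans h1.le)
    (Metric.mem_ball_self hδ) he'
  simpa using this

end Superposition

/-- The bilinear map `(f, g) ↦ ∫ f g` on continuous functions on the torus. -/
noncomputable def integralPairing (d : ℕ) (G : Type*) [NormedAddCommGroup G] [NormedSpace ℝ G]
    [CompleteSpace G] : C(Torus d, ℝ) →L[ℝ] C(Torus d, G) →L[ℝ] G :=
  (ContinuousLinearMap.lpPairing (volume : Measure (Torus d)) ∞ 1
    (ContinuousLinearMap.lsmul ℝ ℝ)).bilinearComp
      (ContinuousMap.toLp ∞ volume ℝ) (ContinuousMap.toLp 1 volume ℝ)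

theorem integralPairing_apply {G : Type*} [NormedAddCommGroup G] [NormedSpace ℝ G]
    [CompleteSpace G] (f : C(Torus d, ℝ)) (g : C(Torus d, G)) :
    integralPairing d G f g = ∫ x, f x • g x := by
  rw [integralPairing, ContinuousLinearMap.bilinearComp_apply,
    ContinuousLinearMap.lpPairing_eq_integral]
  refine integral_congr_ae ?_
  filter_upwards [ContinuousMap.coeFn_toLp (p := ∞) (𝕜 := ℝ) volume f,
    ContinuousMap.coeFn_toLp (p := 1) (𝕜 := ℝ) volume g] with x h1 h2
  rw [h1, h2]
  rfl

theorem integralPairing_clm_apply {E G : Type*} [NormedAddCommGroup E] [NormedSpace ℝ E]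
    [NormedAddCommGroup G] [NormedSpace ℝ G] [CompleteSpace G] (f : C(Torus d, ℝ))
    (K : C(Torus d, E →L[ℝ] G)) (e : E) :
    integralPairing d (E →L[ℝ] G) f K e = ∫ x, f x • K x e := by
  rw [integralPairing_apply, ContinuousLinearMap.integral_apply]
  · rfl
  · exact integrable_of_continuous (f.continuous.smul K.continuous)

theorem differentiableAt_integralPairing {E G : Type*} [NormedAddCommGroup E]
    [NormedSpace ℝ E] [NormedAddCommGroup G] [NormedSpace ℝ G] [CompleteSpace G]
    {f : E → C(Torus d, ℝ)} {g : E → C(Torus d, G)} {e : E} (hf : DifferentiableAt ℝ f e)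
    (hg : DifferentiableAt ℝ g e) :
    DifferentiableAt ℝ (fun e => integralPairing d G (f e) (g e)) e :=
  ((integralPairing d G).hasFDerivAt_of_bilinear hf.hasFDerivAt hg.hasFDerivAt).differentiableAt

/-- The product rule for `m ↦ ∫ m Φ(m)`. -/
theorem hasFDerivAt_integralPairing_self {Φ : C(Torus d, ℝ) → C(Torus d, ℝ)}
    {m : C(Torus d, ℝ)} {K : C(Torus d, C(Torus d, ℝ) →L[ℝ] ℝ)}
    (h : HasFDerivAt Φ (familyCLM K) m) :
    HasFDerivAt (fun m' => integralPairing d ℝ m' (Φ m'))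
      ((integralPairing d ℝ).flip (Φ m)
        + integralPairing d (C(Torus d, ℝ) →L[ℝ] ℝ) m K) m := by
  refine ((integralPairing d ℝ).hasFDerivAt_of_bilinear (hasFDerivAt_id m) h).congr_fderiv ?_
  ext μ
  change integralPairing d ℝ m (familyCLM K μ) + integralPairing d ℝ μ (Φ m)
    = integralPairing d ℝ μ (Φ m) + integralPairing d (C(Torus d, ℝ) →L[ℝ] ℝ) m K μ
  rw [add_comm, integralPairing_clm_apply, integralPairing_apply m]
  rfl

/-! ### Regularity of the Hamiltonian -/

/-- The function on `C(𝕋^d) × ℝ^d × ℝ^d` obtained from `J[m](x, p)` by lifting `x` to `ℝ^d`. -/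
def lift (J : C(Torus d, ℝ) → Torus d → Vec d → F) (z : C(Torus d, ℝ) × Vec d × Vec d) : F :=
  J z.1 (proj z.2.1) z.2.2

theorem continuous_of_lift [TopologicalSpace F] {J : C(Torus d, ℝ) → Torus d → Vec d → F}
    (h : Continuous (lift J)) :
    Continuous fun z : C(Torus d, ℝ) × Torus d × Vec d => J z.1 z.2.1 z.2.2 :=
  ((IsOpenQuotientMap.id.prodMap
    (isOpenQuotientMap_proj.prodMap IsOpenQuotientMap.id)).isQuotientMap.continuous_iff).2 h

section Lift

variable [NormedAddCommGroup F] [NormedSpace ℝ F] {J : C(Torus d, ℝ) → Torus d → Vec d → F}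

theorem hasFDerivAt_of_lift {n : WithTop ℕ∞} (hn : n ≠ 0) (h : ContDiff ℝ n (lift J))
    (m : C(Torus d, ℝ)) (v p : Vec d) :
    HasFDerivAt (fun m' => J m' (proj v) p)
      ((fderiv ℝ (lift J) (m, v, p)).comp (ContinuousLinearMap.inl ℝ _ _)) m :=
  HasFDerivAt.comp (f := fun m' : C(Torus d, ℝ) => (m', v, p)) (g := lift J) m
    (h.differentiable hn (m, v, p)).hasFDerivAt (hasFDerivAt_prodMk_left m (v, p))

theorem differentiable_of_lift {n : WithTop ℕ∞} (hn : n ≠ 0) (h : ContDiff ℝ n (lift J))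
    (x : Torus d) (p : Vec d) : Differentiable ℝ fun m => J m x p := by
  obtain ⟨v, rfl⟩ := proj_surjective x
  exact fun m => (hasFDerivAt_of_lift hn h m v p).differentiableAt

/-- Differentiating in `m` costs one derivative of the lift. -/
theorem contDiff_lift_fderiv {n k : WithTop ℕ∞} (hk : k + 1 ≤ n) (h : ContDiff ℝ n (lift J)) :
    ContDiff ℝ k (lift fun m x p => fderiv ℝ (fun m' => J m' x p) m) := by
  have hn : n ≠ 0 := by
    rintro rfl
    simp at hk
  have e : (lift fun m x p => fderiv ℝ (fun m' => J m' x p) m)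
      = fun z => (fderiv ℝ (lift J) z).comp (ContinuousLinearMap.inl ℝ _ _) := by
    funext z
    exact (hasFDerivAt_of_lift hn h z.1 z.2.1 z.2.2).fderiv
  rw [e]
  exact (h.fderiv_right hk).clm_comp contDiff_const

theorem hasFDerivAt_snd_of_lift {n : WithTop ℕ∞} (hn : n ≠ 0) (h : ContDiff ℝ n (lift J))
    (m : C(Torus d, ℝ)) (v p : Vec d) :
    HasFDerivAt (fun p' => J m (proj v) p')
      ((fderiv ℝ (lift J) (m, v, p)).comp
        ((ContinuousLinearMap.inr ℝ _ _).comp (ContinuousLinearMap.inr ℝ _ _))) p :=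
  HasFDerivAt.comp (f := fun p' : Vec d => (m, v, p')) (g := lift J) p
    (h.differentiable hn (m, v, p)).hasFDerivAt
    ((hasFDerivAt_prodMk_right m (v, p)).comp p (hasFDerivAt_prodMk_right v p))

end Lift

variable {H : C(Torus d, ℝ) → Torus d → Vec d → ℝ}

theorem IsC2Hamiltonian.contDiff_lift (hH : IsC2Hamiltonian H) : ContDiff ℝ 2 (lift H) := hH

theorem IsC2Hamiltonian.contDiff_lift_mDifferential (hH : IsC2Hamiltonian H) :
    ContDiff ℝ 1 (lift (mDifferential H)) :=
  contDiff_lift_fderiv (by norm_num) hH.contDiff_lift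

theorem IsC2Hamiltonian.hasGradientAt (hH : IsC2Hamiltonian H) (m : C(Torus d, ℝ)) (x : Torus d)
    (p : Vec d) : HasGradientAt (fun p' => H m x p') (dHdp H m x p) p := by
  obtain ⟨v, rfl⟩ := proj_surjective x
  exact (hasFDerivAt_snd_of_lift two_ne_zero hH.contDiff_lift m v
    p).differentiableAt.hasGradientAt

theorem IsC2Hamiltonian.contDiff_lift_dHdp (hH : IsC2Hamiltonian H) :
    ContDiff ℝ 1 (lift (dHdp H)) := by
  -- `∂H/∂p` is the part of the derivative of the lift in the last variable, read as a vector
  have e : lift (dHdp H) = fun z => (InnerProductSpace.toDual ℝ (Vec d)).symm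
      ((fderiv ℝ (lift H) z).comp
        ((ContinuousLinearMap.inr ℝ _ _).comp (ContinuousLinearMap.inr ℝ _ _))) := by
    funext z
    rw [← (hasFDerivAt_snd_of_lift two_ne_zero hH.contDiff_lift z.1 z.2.1 z.2.2).fderiv]
    rfl
  rw [e]
  exact (InnerProductSpace.toDual ℝ (Vec d)).symm.contDiff.comp
    ((hH.contDiff_lift.fderiv_right (m := 1) (by norm_num)).clm_comp contDiff_const)

/-! ### The functional `𝓗` and its derivatives -/

/-- The superposition `x ↦ J[m](x, p(x))`, a continuous function on the torus. -/
def superpose {G : Type*} [NormedAddCommGroup G] (J : C(Torus d, ℝ) → Torus d → Vec d → G)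
    (hJ : Continuous (lift J)) (p : C(Torus d, Vec d)) (m : C(Torus d, ℝ)) : C(Torus d, G) :=
  ⟨fun x => J m x (p x), (continuous_of_lift hJ).comp
    (continuous_const.prodMk (continuous_id.prodMk p.continuous))⟩

theorem hasFDerivAt_superpose {G : Type*} [NormedAddCommGroup G] [NormedSpace ℝ G]
    {J : C(Torus d, ℝ) → Torus d → Vec d → G} (hJ : Continuous (lift J))
    {K : C(Torus d, ℝ) → Torus d → Vec d → C(Torus d, ℝ) →L[ℝ] G} (hK : Continuous (lift K))
    (h : ∀ m x p, HasFDerivAt (fun m' => J m' x p) (K m x p) m)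
    (p : C(Torus d, Vec d)) (m : C(Torus d, ℝ)) :
    HasFDerivAt (superpose J hJ p) (familyCLM (superpose K hK p m)) m :=
  hasFDerivAt_superposition (K := superpose K hK p)
    ((continuous_of_lift hK).comp
      (continuous_fst.prodMk (continuous_snd.prodMk (p.continuous.comp continuous_snd))))
    (fun m x => h m x (p x)) m

theorem hamFunctional_eq (hH : IsC2Hamiltonian H) (m : C(Torus d, ℝ)) (p : C(Torus d, Vec d)) :
    hamFunctional H m p
      = integralPairing d ℝ m (superpose H hH.contDiff_lift.continuous p m) := by
  rw [integralPairing_apply]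
  rfl

theorem IsC2Hamiltonian.hasFDerivAt (hH : IsC2Hamiltonian H) (m : C(Torus d, ℝ)) (x : Torus d)
    (p : Vec d) : HasFDerivAt (fun m' => H m' x p) (mDifferential H m x p) m :=
  (differentiable_of_lift two_ne_zero hH.contDiff_lift x p m).hasFDerivAt

/-- The derivative of `𝓗[·, p]`, by the product rule: `𝓗[m, p]` pairs `m` with the superposition
`H[m](·, p)`. The two factors are not differentiated pointwise in `x`, since the evaluations at `x`
do not depend continuously on `x` in the dual of `C(𝕋^d)`. -/
theorem hasFDerivAt_hamFunctional (hH : IsC2Hamiltonian H) (m : C(Torus d, ℝ))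
    (p : C(Torus d, Vec d)) :
    HasFDerivAt (fun m' => hamFunctional H m' p)
      ((integralPairing d ℝ).flip (superpose H hH.contDiff_lift.continuous p m)
        + integralPairing d (C(Torus d, ℝ) →L[ℝ] ℝ) m
            (superpose (mDifferential H) hH.contDiff_lift_mDifferential.continuous p m)) m := by
  simp_rw [hamFunctional_eq hH]
  exact hasFDerivAt_integralPairing_self (hasFDerivAt_superpose hH.contDiff_lift.continuous
    hH.contDiff_lift_mDifferential.continuous hH.hasFDerivAt p m)

/-- `𝓗[·, p]` is twice differentiable, so that its Hessian is a genuine second derivative. -/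
theorem differentiable_fderiv_hamFunctional (hH : IsC2Hamiltonian H) (p : C(Torus d, Vec d)) :
    Differentiable ℝ fun m => fderiv ℝ (fun m' => hamFunctional H m' p) m := by
  simp_rw [fun m => (hasFDerivAt_hamFunctional hH m p).fderiv]
  intro m
  have h1 := (hasFDerivAt_superpose hH.contDiff_lift.continuous
    hH.contDiff_lift_mDifferential.continuous hH.hasFDerivAt p m).differentiableAt
  have h2 := (hasFDerivAt_superpose hH.contDiff_lift_mDifferential.continuous
    (contDiff_lift_fderiv (k := 0) (by norm_num) hH.contDiff_lift_mDifferential).continuous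
    (fun m x p => (differentiable_of_lift one_ne_zero hH.contDiff_lift_mDifferential x p
      m).hasFDerivAt) p m).differentiableAt
  exact ((integralPairing d ℝ).flip.differentiableAt.comp m h1).add
    (differentiableAt_integralPairing differentiableAt_id h2)

/-- Testing the nonlocal term against `μ`. -/
theorem integral_nonlocal_mul (hHm : HasBoundedMDerivative H) (m μ : C(Torus d, ℝ))
    (p : C(Torus d, Vec d)) :
    ∫ x, nonlocal H m p x * μ x = ∫ x, m x * mDifferential H m x (p x) μ := by
  set Λ : Lp ℝ ∞ (volume : Measure (Torus d)) →L[ℝ] ℝ :=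
    (ContinuousLinearMap.lpPairing (volume : Measure (Torus d)) ∞ 1
      (ContinuousLinearMap.lsmul ℝ ℝ)).flip (ContinuousMap.toLp 1 volume ℝ μ) with hΛ
  have hΛ_apply : ∀ k, Λ k = ∫ x, k x * μ x := by
    intro k
    rw [hΛ, ContinuousLinearMap.flip_apply, ContinuousLinearMap.lpPairing_eq_integral]
    refine integral_congr_ae ?_
    filter_upwards [ContinuousMap.coeFn_toLp (p := 1) (𝕜 := ℝ) volume μ] with x h1
    rw [h1]
    rfl
  have hc : Continuous fun ξ => m ξ • dHdm H m ξ (p ξ) :=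
    m.continuous.smul ((hHm.continuous_density m).comp (continuous_id.prodMk p.continuous))
  rw [← hΛ_apply, nonlocal, ← Λ.integral_comp_comm (integrable_of_continuous hc)]
  refine integral_congr_ae (Eventually.of_forall fun ξ => ?_)
  change Λ (m ξ • dHdm H m ξ (p ξ)) = _
  rw [map_smul, smul_eq_mul, hΛ_apply, ← represents_dHdm (hHm.exists_density m ξ (p ξ)) μ]

theorem integrable_Lp_mul (k : Lp ℝ ∞ (volume : Measure (Torus d))) (μ : C(Torus d, ℝ)) :
    Integrable fun x => k x * μ x := by
  have hk : Integrable fun x => k x :=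
    ((Lp.memLp k).mono_exponent (q := ∞) (p := 1) le_top).integrable le_rfl
  exact hk.mul_bdd (c := ‖μ‖) μ.continuous.aestronglyMeasurable
    (Eventually.of_forall fun x => μ.norm_coe_le_norm x)

theorem continuous_hamiltonian (hH : IsC2Hamiltonian H) (m : C(Torus d, ℝ))
    (p : C(Torus d, Vec d)) : Continuous fun x => H m x (p x) :=
  (superpose H hH.contDiff_lift.continuous p m).continuous

/-- The derivative of `𝓗[·, p]` at `m` is represented by `H[m](·, p) + G[m, p]`, the zeroth order
terms of the Hamilton-Jacobi-Bellman equation. -/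
theorem fderiv_hamFunctional_apply (hHm : HasBoundedMDerivative H) (hH : IsC2Hamiltonian H)
    (m μ : C(Torus d, ℝ)) (p : C(Torus d, Vec d)) :
    fderiv ℝ (fun m' => hamFunctional H m' p) m μ
      = ∫ x, (H m x (p x) + nonlocal H m p x) * μ x := by
  rw [(hasFDerivAt_hamFunctional hH m p).fderiv, add_apply,
    ContinuousLinearMap.flip_apply, integralPairing_apply, integralPairing_clm_apply]
  simp_rw [add_mul]
  rw [integral_add _ (integrable_Lp_mul _ μ), integral_nonlocal_mul hHm]
  · congr 1
    exact integral_congr_ae (Eventually.of_forall fun x => mul_comm _ _)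
  · exact integrable_of_continuous ((continuous_hamiltonian hH m p).mul μ.continuous)

/-! ### Convexity in the density, concavity in the momentum -/

theorem IsProbDensity.segment {m m' : C(Torus d, ℝ)} (hm : IsProbDensity m)
    (hm' : IsProbDensity m') {s : ℝ} (h0 : 0 ≤ s) (h1 : s ≤ 1) :
    IsProbDensity (m + s • (m' - m)) where
  nonneg x := by
    have := hm.nonneg x
    have := hm'.nonneg x
    simp only [ContinuousMap.add_apply, ContinuousMap.smul_apply, ContinuousMap.sub_apply,
      smul_eq_mul]
    nlinarith
  integral_eq_one := by
    simp only [ContinuousMap.add_apply, ContinuousMap.smul_apply, ContinuousMap.sub_apply,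
      smul_eq_mul]
    rw [integral_add (integrable_of_continuous m.continuous)
      (integrable_of_continuous (by fun_prop)), integral_const_mul,
      integral_sub (integrable_of_continuous m'.continuous)
      (integrable_of_continuous m.continuous), hm.integral_eq_one, hm'.integral_eq_one]
    simp

/-- Strict convexity of `𝓗[·, p]` on probability densities: the function lies above its tangent.
Along the segment from `m` to `m'` the second derivative is a value of the Hessian, hence
positive. -/
theorem hamFunctional_tangent_lt (hH : IsC2Hamiltonian H)
    (hpos : ∀ m : C(Torus d, ℝ), IsProbDensity m →
      ∀ p : C(Torus d, Vec d), ∀ μ : C(Torus d, ℝ), μ ≠ 0 → 0 < hamHessian H m p μ μ)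
    {m m' : C(Torus d, ℝ)} (hm : IsProbDensity m) (hm' : IsProbDensity m') (hne : m ≠ m')
    (p : C(Torus d, Vec d)) :
    hamFunctional H m p + fderiv ℝ (fun m₁ => hamFunctional H m₁ p) m (m' - m)
      < hamFunctional H m' p := by
  set μ := m' - m with hμ
  have hμ0 : μ ≠ 0 := sub_ne_zero.2 hne.symm
  set γ : ℝ → C(Torus d, ℝ) := fun s => m + s • μ with hγ
  have hγ' : ∀ s, HasDerivAt γ μ s := fun s => by
    simpa [hγ] using ((hasDerivAt_id s).smul_const μ).const_add m
  set φ : ℝ → ℝ := fun s => hamFunctional H (γ s) p with hφ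
  set ψ : ℝ → ℝ := fun s => fderiv ℝ (fun m₁ => hamFunctional H m₁ p) (γ s) μ with hψ
  have hφ' : ∀ s, HasDerivAt φ (ψ s) s := fun s =>
    (hasFDerivAt_hamFunctional hH (γ s) p).differentiableAt.hasFDerivAt.comp_hasDerivAt s (hγ' s)
  have hψ' : ∀ s, HasDerivAt ψ (hamHessian H (γ s) p μ μ) s := fun s => by
    have := HasFDerivAt.comp_hasDerivAt (F := C(Torus d, ℝ)) (E := C(Torus d, ℝ) →L[ℝ] ℝ) s
      (differentiable_fderiv_hamFunctional hH p (γ s)).hasFDerivAt (hγ' s)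
    have := this.clm_apply (hasDerivAt_const s μ)
    rw [map_zero, add_zero] at this
    exact this
  have hmono : StrictMonoOn ψ (Icc 0 1) := by
    refine strictMonoOn_of_deriv_pos (convex_Icc 0 1)
      (fun s _ => (hψ' s).continuousAt.continuousWithinAt) fun s hs => ?_
    rw [interior_Icc] at hs
    rw [(hψ' s).deriv]
    exact hpos _ (hm.segment hm' hs.1.le hs.2.le) p μ hμ0
  obtain ⟨c, hc, hc'⟩ := exists_hasDerivAt_eq_slope φ ψ zero_lt_one
    (fun s _ => (hφ' s).continuousAt.continuousWithinAt) fun s _ => hφ' s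
  have h01 : ψ 0 < ψ c := hmono (by simp) ⟨hc.1.le, hc.2.le⟩ hc.1
  have e0 : γ 0 = m := by simp [hγ]
  have e1 : γ 1 = m' := by simp [hγ, hμ]
  rw [hc'] at h01
  simp only [hφ, hψ, e0, e1] at h01
  linarith

/-- A differentiable strictly concave function lies strictly below its tangents. -/
theorem _root_.StrictConcaveOn.lt_tangent {E : Type*} [NormedAddCommGroup E]
    [InnerProductSpace ℝ E] [CompleteSpace E] {f : E → ℝ} (hf : StrictConcaveOn ℝ univ f)
    {p q g : E} (hg : HasGradientAt f g p) (hne : p ≠ q) :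
    f q < f p + inner ℝ g (q - p) := by
  set γ : ℝ → E := fun s => p + s • (q - p) with hγ
  have hγ' : HasDerivAt γ (q - p) 0 := by
    simpa [hγ] using ((hasDerivAt_id (0 : ℝ)).smul_const (q - p)).const_add p
  have h0 : γ 0 = p := by simp [hγ]
  have h1 : γ 1 = q := by simp [hγ]
  have hconc : StrictConcaveOn ℝ univ (f ∘ γ) := by
    refine ⟨convex_univ, fun a _ b _ hab s t hs ht hst => ?_⟩
    have hab' : γ a ≠ γ b := by
      intro h
      have h2 : a • (q - p) = b • (q - p) := add_left_cancel h
      exact hab (smul_left_injective ℝ (sub_ne_zero.2 hne.symm) h2)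
    have h3 := hf.2 (mem_univ (γ a)) (mem_univ (γ b)) hab' hs ht hst
    have h4 : s • γ a + t • γ b = γ (s • a + t • b) := by
      simp only [hγ, smul_add, smul_eq_mul, add_smul, smul_smul]
      rw [add_add_add_comm, ← add_smul, hst, one_smul]
    rw [h4] at h3
    exact h3
  have hd : HasDerivAt (f ∘ γ) (inner ℝ g (q - p)) 0 := by
    have h5 : HasFDerivAt f (InnerProductSpace.toDual ℝ E g) (γ 0) := by
      rw [h0]
      exact hg.hasFDerivAt
    simpa using h5.comp_hasDerivAt 0 hγ'
  have := hconc.slope_lt_of_hasDerivAt (mem_univ 0) (mem_univ 1) zero_lt_one hd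
  rw [slope_def_field] at this
  simp only [Function.comp, h0, h1] at this
  linarith

theorem continuous_dHdp (hH : IsC2Hamiltonian H) (m : C(Torus d, ℝ)) (p : C(Torus d, Vec d)) :
    Continuous fun x => dHdp H m x (p x) :=
  (superpose (dHdp H) hH.contDiff_lift_dHdp.continuous p m).continuous

/-- Concavity of `𝓗[m, ·]`: since `m ≥ 0`, the pointwise tangent inequality can be integrated. -/
theorem hamFunctional_le_tangent (hH : IsC2Hamiltonian H)
    (hconc : ∀ m : C(Torus d, ℝ), IsProbDensity m → ∀ x : Torus d,
      StrictConcaveOn ℝ univ (fun p : Vec d => H m x p))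
    {m : C(Torus d, ℝ)} (hm : IsProbDensity m) (p q : C(Torus d, Vec d)) :
    hamFunctional H m q ≤ hamFunctional H m p
      + ∫ x, inner ℝ (q x - p x) (m x • dHdp H m x (p x)) := by
  have hi1 : Integrable fun x => inner ℝ (q x - p x) (m x • dHdp H m x (p x)) :=
    integrable_of_continuous ((q.continuous.sub p.continuous).inner
      (m.continuous.smul (continuous_dHdp hH m p)))
  have hi : ∀ p : C(Torus d, Vec d), Integrable fun x => m x * H m x (p x) := fun p =>
    integrable_of_continuous (m.continuous.mul (continuous_hamiltonian hH m p))
  rw [hamFunctional, hamFunctional, ← integral_add (hi p) hi1]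
  refine integral_mono (hi q) ((hi p).add hi1) fun x => ?_
  by_cases hx : p x = q x
  · simp [hx]
  · have := (hconc m hm x).lt_tangent (hH.hasGradientAt m x (p x)) hx
    simp only [inner_smul_right, real_inner_comm (dHdp H m x (p x))]
    rw [← mul_add]
    exact mul_le_mul_of_nonneg_left this.le (hm.nonneg x)

/-- Where the density is positive everywhere, concavity in the momentum is strict. -/
theorem hamFunctional_lt_tangent (hH : IsC2Hamiltonian H)
    (hconc : ∀ m : C(Torus d, ℝ), IsProbDensity m → ∀ x : Torus d,
      StrictConcaveOn ℝ univ (fun p : Vec d => H m x p))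
    {m : C(Torus d, ℝ)} (hm : IsProbDensity m) (hm_pos : ∀ x, 0 < m x) {p q : C(Torus d, Vec d)}
    (hne : p ≠ q) :
    hamFunctional H m q < hamFunctional H m p
      + ∫ x, inner ℝ (q x - p x) (m x • dHdp H m x (p x)) := by
  have hc1 : Continuous fun x => inner ℝ (q x - p x) (m x • dHdp H m x (p x)) :=
    (q.continuous.sub p.continuous).inner (m.continuous.smul (continuous_dHdp hH m p))
  have hc : ∀ p : C(Torus d, Vec d), Continuous fun x => m x * H m x (p x) := fun p =>
    m.continuous.mul (continuous_hamiltonian hH m p)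
  have hlt : ∀ x, p x ≠ q x → m x * H m x (q x) < m x * H m x (p x)
      + inner ℝ (q x - p x) (m x • dHdp H m x (p x)) := by
    intro x hx
    have := (hconc m hm x).lt_tangent (hH.hasGradientAt m x (p x)) hx
    rw [inner_smul_right, real_inner_comm, ← mul_add]
    exact mul_lt_mul_of_pos_left this (hm_pos x)
  obtain ⟨x₀, hx₀⟩ : ∃ x, p x ≠ q x := by
    by_contra! h
    exact hne (ContinuousMap.ext h)
  have h := integral_pos_of_integrable_nonneg_nonzero (μ := (volume : Measure (Torus d)))
    (f := fun x => m x * H m x (p x) + inner ℝ (q x - p x) (m x • dHdp H m x (p x))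
      - m x * H m x (q x)) (x := x₀) (((hc p).add hc1).sub (hc q))
    (integrable_of_continuous (((hc p).add hc1).sub (hc q)))
    (fun x => by
      by_cases hx : p x = q x
      · simp [hx]
      · exact (sub_pos.2 (hlt x hx)).le)
    (sub_pos.2 (hlt x₀ hx₀)).ne'
  rw [integral_sub (f := fun x => m x * H m x (p x) + inner ℝ (q x - p x) (m x • dHdp H m x (p x)))
    (integrable_of_continuous ((hc p).add hc1)) (integrable_of_continuous (hc q)),
    integral_add (integrable_of_continuous (hc p)) (integrable_of_continuous hc1)] at h
  rw [hamFunctional, hamFunctional]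
  linarith

/-! ### Functions of class `C^{1,2}` -/

section C12

variable {T t : ℝ} {w : ℝ → C(Torus d, ℝ)}

theorem IsC12.continuousOn_curve (hw : IsC12 T w) : ContinuousOn w (Icc 0 T) := by
  rw [continuousOn_iff_continuous_domRestrict]
  refine ContinuousMap.continuous_of_continuous_uncurry _ ?_
  exact hw.continuousOn.comp_continuous
    (f := fun z : Icc (0 : ℝ) T × Torus d => ((z.1 : ℝ), z.2)) (by fun_prop)
    fun z => ⟨z.1.2, mem_univ _⟩

theorem IsC12.contDiff_one (hw : IsC12 T w) (ht : t ∈ Ioo 0 T) (x : Torus d) :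
    ContDiff ℝ 1 (chart (w t) x) :=
  (hw.space_contDiff t ht x).of_le one_le_two

theorem IsC12.continuous_deriv (hw : IsC12 T w) (ht : t ∈ Ioo 0 T) :
    Continuous fun x => deriv (fun s => w s x) t :=
  hw.time_continuous.comp_continuous (f := fun x : Torus d => (t, x)) (by fun_prop)
    fun _ => ⟨ht, mem_univ _⟩

theorem IsC12.continuousOn_grad (hw : IsC12 T w) :
    ContinuousOn (fun z : ℝ × Torus d => grad (w z.1) z.2) (Ioo 0 T ×ˢ univ) := by
  have h := hw.space_continuous 1 one_le_two
  have e : (fun z : ℝ × Torus d => grad (w z.1) z.2) = fun z =>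
      (InnerProductSpace.toDual ℝ (Vec d)).symm
        (continuousMultilinearCurryFin1 ℝ (Vec d) ℝ
          (iteratedFDeriv ℝ 1 (chart (w z.1) z.2) 0)) := by
    funext z
    rw [grad, gradient]
    congr 1
    ext v
    simp
  rw [e]
  exact (InnerProductSpace.toDual ℝ (Vec d)).symm.continuous.comp_continuousOn
    ((continuousMultilinearCurryFin1 ℝ (Vec d) ℝ).continuous.comp_continuousOn h)

/-- Differentiation under the integral over the torus. -/
theorem hasDerivAt_integral_torus {f f' : ℝ → Torus d → ℝ}
    (hf : ContinuousOn (fun z : ℝ × Torus d => f z.1 z.2) (Ioo 0 T ×ˢ univ))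
    (hf' : ContinuousOn (fun z : ℝ × Torus d => f' z.1 z.2) (Ioo 0 T ×ˢ univ))
    (h : ∀ t ∈ Ioo 0 T, ∀ x, HasDerivAt (fun s => f s x) (f' t x) t) (ht : t ∈ Ioo 0 T) :
    HasDerivAt (fun s => ∫ x, f s x) (∫ x, f' t x) t := by
  obtain ⟨ε, hε, hsub⟩ := Metric.nhds_basis_closedBall.mem_iff.1 (isOpen_Ioo.mem_nhds ht)
  have hcf : ∀ s ∈ Ioo 0 T, Continuous (f s) := fun s hs =>
    hf.comp_continuous (f := fun x : Torus d => (s, x)) (by fun_prop) fun _ => ⟨hs, mem_univ _⟩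
  have hcf' : Continuous (f' t) :=
    hf'.comp_continuous (f := fun x : Torus d => (t, x)) (by fun_prop) fun _ => ⟨ht, mem_univ _⟩
  obtain ⟨C, hC⟩ := ((isCompact_closedBall t ε).prod
    (isCompact_univ (X := Torus d))).exists_bound_of_continuousOn
      (hf'.mono (prod_mono hsub Subset.rfl))
  exact (hasDerivAt_integral_of_dominated_loc_of_deriv_le (bound := fun _ => C)
    (Metric.closedBall_mem_nhds t hε)
    (by
      filter_upwards [isOpen_Ioo.mem_nhds ht] with s hs
      exact (hcf s hs).aestronglyMeasurable)
    (integrable_of_continuous (hcf t ht)) hcf'.aestronglyMeasurable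
    (Eventually.of_forall fun x s hs => hC (s, x) ⟨hs, mem_univ _⟩) (integrable_const C)
    (Eventually.of_forall fun x s hs => h s (hsub hs) x)).2

theorem IsC12.hasDerivAt (hw : IsC12 T w) (ht : t ∈ Ioo 0 T) (x : Torus d) :
    HasDerivAt (fun s => w s x) (deriv (fun s => w s x) t) t :=
  (hw.time_differentiable t ht x).hasDerivAt

theorem IsC12.continuousOn_Ioo (hw : IsC12 T w) :
    ContinuousOn (fun z : ℝ × Torus d => w z.1 z.2) (Ioo 0 T ×ˢ univ) :=
  hw.continuousOn.mono (prod_mono Ioo_subset_Icc_self Subset.rfl)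

end C12

/-! ### The drift of the Fokker-Planck equation -/

/-- The drift `∂H/∂p [m](·, ∇u)`. -/
noncomputable def drift (H : C(Torus d, ℝ) → Torus d → Vec d → ℝ) (m u : C(Torus d, ℝ))
    (x : Torus d) : Vec d :=
  dHdp H m x (grad u x)

theorem chart_drift (m u : C(Torus d, ℝ)) (v : Vec d) :
    chart (drift H m u) (proj v)
      = fun z => lift (dHdp H) (m, v + z, chart (grad u) (proj v) z) := by
  funext z
  simp [chart, drift, lift]

theorem contDiff_chart_drift (hH : IsC2Hamiltonian H) {m u : C(Torus d, ℝ)}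
    (hu : ∀ x, ContDiff ℝ 2 (chart u x)) (x : Torus d) : ContDiff ℝ 1 (chart (drift H m u) x) := by
  obtain ⟨v, rfl⟩ := proj_surjective x
  rw [chart_drift]
  exact hH.contDiff_lift_dHdp.comp (contDiff_const.prodMk
    ((contDiff_const.add contDiff_id).prodMk (contDiff_chart_grad (hu _))))

/-- The derivative of `J[m](x, p)` with respect to all of its arguments. -/
noncomputable def totalFDeriv {F : Type*} [NormedAddCommGroup F] [NormedSpace ℝ F]
    (J : C(Torus d, ℝ) → Torus d → Vec d → F) (m : C(Torus d, ℝ)) (x : Torus d) (p : Vec d) :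
    C(Torus d, ℝ) × Vec d × Vec d →L[ℝ] F :=
  fderiv ℝ (fun z : C(Torus d, ℝ) × Vec d × Vec d => J (m + z.1) (x + proj z.2.1) (p + z.2.2)) 0

theorem lift_totalFDeriv {F : Type*} [NormedAddCommGroup F] [NormedSpace ℝ F]
    (J : C(Torus d, ℝ) → Torus d → Vec d → F) : lift (totalFDeriv J) = fderiv ℝ (lift J) := by
  funext z
  have h := fderiv_comp_add_left (𝕜 := ℝ) (f := lift J) (x := 0) z
  rw [add_zero] at h
  rw [← h, lift, totalFDeriv]
  congr 1

theorem continuous_norm_totalFDeriv {F : Type*} [NormedAddCommGroup F] [NormedSpace ℝ F]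
    {J : C(Torus d, ℝ) → Torus d → Vec d → F} (hJ : ContDiff ℝ 1 (lift J)) :
    Continuous fun z : C(Torus d, ℝ) × Torus d × Vec d => ‖totalFDeriv J z.1 z.2.1 z.2.2‖ := by
  apply continuous_of_lift (J := fun m x p => ‖totalFDeriv J m x p‖)
  have e : (lift fun m x p => ‖totalFDeriv J m x p‖) = fun z => ‖fderiv ℝ (lift J) z‖ := by
    rw [← lift_totalFDeriv]
    rfl
  rw [e]
  exact Continuous.norm (E := C(Torus d, ℝ) × Vec d × Vec d →L[ℝ] F)
    (hJ.continuous_fderiv one_ne_zero)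

theorem norm_fderiv_chart_grad_le (u : Torus d → ℝ) (x : Torus d) :
    ‖fderiv ℝ (chart (grad u) x) 0‖ ≤ ‖iteratedFDeriv ℝ 2 (chart u x) 0‖ := by
  have h := (InnerProductSpace.toDual ℝ (Vec d)).symm.comp_fderiv (f := fderiv ℝ (chart u x))
    (x := 0)
  have e : fderiv ℝ (chart (grad u) x) 0 = _ := (congrArg (fderiv ℝ · 0) (chart_grad u x)).trans h
  have h2 : ‖fderiv ℝ (fderiv ℝ (chart u x)) 0‖ = ‖iteratedFDeriv ℝ 2 (chart u x) 0‖ := by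
    rw [← norm_iteratedFDeriv_fderiv, ← norm_iteratedFDeriv_one]
  rw [← h2]
  refine ContinuousLinearMap.opNorm_le_bound _ (by positivity) fun z => ?_
  rw [e]
  refine le_trans (le_of_eq ?_) ((fderiv ℝ (fderiv ℝ (chart u x)) 0).le_opNorm z)
  exact (InnerProductSpace.toDual ℝ (Vec d)).symm.norm_map _

theorem abs_divergence_le {V : Torus d → Vec d} {x : Torus d}
    (hV : DifferentiableAt ℝ (chart V x) 0) :
    |divergence V x| ≤ d * ‖fderiv ℝ (chart V x) 0‖ := by
  have key : ∀ i : Fin d, |fderiv ℝ (chart (fun y => V y i) x) 0 (EuclideanSpace.single i 1)|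
      ≤ ‖fderiv ℝ (chart V x) 0‖ := by
    intro i
    have h := ((EuclideanSpace.proj (𝕜 := ℝ) i).hasFDerivAt.comp 0 hV.hasFDerivAt).fderiv
    have h2 : fderiv ℝ (chart (fun y => V y i) x) 0 = _ := h
    rw [h2]
    calc |fderiv ℝ (chart V x) 0 (EuclideanSpace.single i 1) i|
        ≤ ‖fderiv ℝ (chart V x) 0 (EuclideanSpace.single i 1)‖ := by
          rw [← Real.norm_eq_abs]
          exact PiLp.norm_apply_le _ i
      _ ≤ ‖fderiv ℝ (chart V x) 0‖ * ‖EuclideanSpace.single i (1 : ℝ)‖ :=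
        ContinuousLinearMap.le_opNorm _ _
      _ = ‖fderiv ℝ (chart V x) 0‖ := by simp
  calc |divergence V x| ≤ ∑ i : Fin d, ‖fderiv ℝ (chart V x) 0‖ :=
        (Finset.abs_sum_le_sum_abs _ _).trans (Finset.sum_le_sum fun i _ => key i)
    _ = d * ‖fderiv ℝ (chart V x) 0‖ := by simp

theorem norm_fderiv_chart_drift_le (hH : IsC2Hamiltonian H) {m u : C(Torus d, ℝ)} {x : Torus d}
    (hu : ContDiff ℝ 2 (chart u x)) :
    ‖fderiv ℝ (chart (drift H m u) x) 0‖
      ≤ ‖totalFDeriv (dHdp H) m x (grad u x)‖ * (1 + ‖iteratedFDeriv ℝ 2 (chart u x) 0‖) := by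
  have hg : DifferentiableAt ℝ (chart (grad u) x) 0 :=
    (contDiff_chart_grad hu).differentiable one_ne_zero 0
  refine le_trans ?_ (mul_le_mul_of_nonneg_left
    (add_le_add_right (norm_fderiv_chart_grad_le u x) 1)
    (norm_nonneg (totalFDeriv (dHdp H) m x (grad u x))))
  obtain ⟨v, rfl⟩ := proj_surjective x
  have e : totalFDeriv (dHdp H) m (proj v) (grad u (proj v))
      = fderiv ℝ (lift (dHdp H)) (m, v, grad u (proj v)) := by
    rw [← lift_totalFDeriv]
    rfl
  have h1 : HasFDerivAt (lift (dHdp H)) (totalFDeriv (dHdp H) m (proj v) (grad u (proj v)))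
      (m, v + 0, chart (grad u) (proj v) 0) := by
    rw [e, add_zero, chart_zero]
    exact (hH.contDiff_lift_dHdp.differentiable one_ne_zero _).hasFDerivAt
  have h2 := HasFDerivAt.comp (f := fun z : Vec d => (m, v + z, chart (grad u) (proj v) z)) 0 h1
    ((hasFDerivAt_const m 0).prodMk
      (((hasFDerivAt_id (𝕜 := ℝ) (0 : Vec d)).const_add v).prodMk hg.hasFDerivAt))
  rw [chart_drift]
  have h3 : fderiv ℝ (fun z => lift (dHdp H) (m, v + z, chart (grad u) (proj v) z)) 0 = _ :=
    h2.fderiv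
  rw [h3]
  refine (ContinuousLinearMap.opNorm_comp_le _ _).trans ?_
  gcongr
  refine ContinuousLinearMap.opNorm_le_bound _ (by positivity) fun z => ?_
  have hz := (fderiv ℝ (chart (grad u) (proj v)) 0).le_opNorm z
  have hz0 := norm_nonneg z
  have hn := norm_nonneg (fderiv ℝ (chart (grad u) (proj v)) 0)
  simp only [ContinuousLinearMap.prod_apply, Prod.norm_def, zero_apply,
    norm_zero, ContinuousLinearMap.id_apply]
  refine max_le (by positivity) (max_le ?_ ?_) <;> nlinarith

/-- On a compact subinterval of `(0, T)` the divergence of the drift is bounded. -/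
theorem exists_bound_divergence_drift (hH : IsC2Hamiltonian H) {T a b : ℝ}
    {u m : ℝ → C(Torus d, ℝ)} (hu : IsC12 T u) (hm : IsC12 T m) (ha : 0 < a) (hb : b < T) :
    ∃ C, ∀ t ∈ Icc a b, ∀ x, |divergence (drift H (m t) (u t)) x| ≤ C := by
  have hsub : Icc a b ⊆ Ioo 0 T := fun t ht => ⟨ha.trans_le ht.1, ht.2.trans_lt hb⟩
  have h1 : ContinuousOn (fun z : ℝ × Torus d => (m z.1, z.2, grad (u z.1) z.2))
      (Icc a b ×ˢ univ) :=
    (hm.continuousOn_curve.comp continuousOn_fst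
      fun z hz => Ioo_subset_Icc_self (hsub hz.1)).prodMk
      (continuousOn_snd.prodMk (hu.continuousOn_grad.mono (prod_mono hsub Subset.rfl)))
  have h2 : ContinuousOn (fun z : ℝ × Torus d =>
      (d : ℝ) * (‖totalFDeriv (dHdp H) (m z.1) z.2 (grad (u z.1) z.2)‖
        * (1 + ‖iteratedFDeriv ℝ 2 (chart (u z.1) z.2) 0‖))) (Icc a b ×ˢ univ) := by
    have h3 := (continuous_norm_totalFDeriv hH.contDiff_lift_dHdp).comp_continuousOn h1
    have h4 := ((hu.space_continuous 2 le_rfl).mono (prod_mono hsub Subset.rfl)).norm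
    exact continuousOn_const.mul (h3.mul (continuousOn_const.add h4))
  obtain ⟨C, hC⟩ :=
    (isCompact_Icc.prod (isCompact_univ (X := Torus d))).exists_bound_of_continuousOn h2
  refine ⟨C, fun t ht x => ?_⟩
  refine (abs_divergence_le
    ((contDiff_chart_drift hH (hu.space_contDiff t (hsub ht)) x).differentiable one_ne_zero
      0)).trans ?_
  refine (mul_le_mul_of_nonneg_left (norm_fderiv_chart_drift_le hH
    (hu.space_contDiff t (hsub ht) x)) (Nat.cast_nonneg d)).trans ?_
  exact (le_abs_self _).trans (hC (t, x) ⟨ht, mem_univ _⟩)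

/-! ### Positivity and mass of the density -/

/-- The second derivative test along the line through `0` in direction `v`. -/
theorem second_derivative_nonneg_of_min {E : Type*} [NormedAddCommGroup E] [NormedSpace ℝ E]
    {f : E → ℝ} (hf : ContDiff ℝ 2 f) (hmin : ∀ v, f 0 ≤ f v) (v : E) :
    0 ≤ iteratedFDeriv ℝ 2 f 0 ![v, v] := by
  rw [iteratedFDeriv_two_apply]
  simp only [Matrix.cons_val_zero, Matrix.cons_val_one]
  have hline : ∀ s : ℝ, HasDerivAt (fun s : ℝ => s • v) v s := fun s => by
    simpa using (hasDerivAt_id s).smul_const v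
  set φ : ℝ → ℝ := fun s => f (s • v) with hφ
  have h1 : ∀ s, HasDerivAt φ (fderiv ℝ f (s • v) v) s := fun s =>
    (hf.differentiable two_ne_zero _).hasFDerivAt.comp_hasDerivAt s (hline s)
  have h2 : HasDerivAt (fun s : ℝ => fderiv ℝ f (s • v) v) (fderiv ℝ (fderiv ℝ f) 0 v v) 0 := by
    have hd : HasFDerivAt (fderiv ℝ f) (fderiv ℝ (fderiv ℝ f) 0) ((0 : ℝ) • v) := by
      rw [zero_smul]
      exact ((hf.fderiv_right (m := 1) (by norm_num)).differentiable one_ne_zero 0).hasFDerivAt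
    have h3 : HasDerivAt (fun s : ℝ => fderiv ℝ f (s • v)) (fderiv ℝ (fderiv ℝ f) 0 v) 0 :=
      HasFDerivAt.comp_hasDerivAt (F := E) (E := E →L[ℝ] ℝ) (0 : ℝ) hd (hline 0)
    have := h3.clm_apply (hasDerivAt_const 0 v)
    rw [map_zero, add_zero] at this
    exact this
  have hderiv : deriv φ = fun s : ℝ => fderiv ℝ f (s • v) v := funext fun s => (h1 s).deriv
  have hge : ∀ s, φ 0 ≤ φ s := fun s => by simpa [hφ] using hmin (s • v)
  have hmin0 : IsLocalMin φ 0 := Eventually.of_forall hge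
  by_contra! hneg
  have hmax : IsLocalMax φ 0 := by
    refine isLocalMax_of_deriv_deriv_neg ?_ hmin0.deriv_eq_zero (h1 0).continuousAt
    rw [hderiv, h2.deriv]
    exact hneg
  -- a local maximum that is a global minimum: `φ` is constant near `0`
  have hconst : φ =ᶠ[𝓝 0] fun _ => φ 0 := by
    filter_upwards [hmax] with s hs
    exact le_antisymm hs (hge s)
  have h3 : deriv (deriv φ) 0 = 0 := by
    rw [hconst.deriv.deriv_eq]
    simp
  rw [hderiv, h2.deriv] at h3
  exact hneg.ne h3

theorem lap_nonneg_of_min {w : Torus d → ℝ} {x : Torus d} (hw : ContDiff ℝ 2 (chart w x))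
    (hmin : ∀ y, w x ≤ w y) : 0 ≤ lap w x := by
  rw [lap, InnerProductSpace.laplacian_eq_iteratedFDeriv_orthonormalBasis _
    (EuclideanSpace.basisFun (Fin d) ℝ)]
  exact Finset.sum_nonneg fun i _ =>
    second_derivative_nonneg_of_min hw (fun v => by rw [chart_zero]; exact hmin _) _

theorem grad_eq_zero_of_min {w : Torus d → ℝ} {x : Torus d} (hmin : ∀ y, w x ≤ w y) :
    grad w x = 0 := by
  have h : IsLocalMin (chart w x) 0 :=
    Eventually.of_forall fun v => by
      rw [chart_zero]
      exact hmin _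
  rw [grad, gradient, h.fderiv_eq_zero, map_zero]

/-- A function that is nonnegative to the left of a zero has a nonpositive derivative there. -/
theorem deriv_nonpos_of_nonneg_left {f : ℝ → ℝ} {f' a t : ℝ} (hat : a < t)
    (hf : HasDerivAt f f' t) (h0 : f t = 0) (hnonneg : ∀ s ∈ Ico a t, 0 ≤ f s) : f' ≤ 0 := by
  have h1 : Tendsto (slope f t) (𝓝[<] t) (𝓝 f') :=
    hf.tendsto_slope.mono_left (nhdsWithin_mono _ fun s hs => ne_of_lt hs)
  refine le_of_tendsto h1 ?_
  filter_upwards [Ico_mem_nhdsLT hat] with s hs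
  rw [slope_def_field, h0, sub_zero]
  exact div_nonpos_of_nonneg_of_nonpos (hnonneg s hs) (by linarith [hs.2])

variable {ν T : ℝ} {uT m₀ : C(Torus d, ℝ)} {u m : ℝ → C(Torus d, ℝ)}

/-- The Fokker-Planck equation with the divergence expanded. -/
theorem IsClassicalSolution.deriv_density (h : IsClassicalSolution ν T H uT m₀ u m)
    (hH : IsC2Hamiltonian H) {t : ℝ} (ht : t ∈ Ioo 0 T) (x : Torus d) :
    deriv (fun s => m s x) t = ν * lap (m t) x
      - (m t x * divergence (drift H (m t) (u t)) x
        + inner ℝ (grad (m t) x) (drift H (m t) (u t) x)) := by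
  have h1 := h.fokkerPlanck t ht x
  have h2 := divergence_smul (w := m t) (V := drift H (m t) (u t)) (x := x)
    ((h.regular_m.contDiff_one ht x).differentiable one_ne_zero 0)
    ((contDiff_chart_drift hH (h.regular_u.space_contDiff t ht) x).differentiable one_ne_zero 0)
  have h3 : divergence (fun y => m t y • drift H (m t) (u t) y) x
    = divergence (fun y => m t y • dHdp H (m t) y (grad (u t) y)) x := rfl
  rw [← h2, h3]
  linarith

/-- Minimum principle: if `m(a, ·) > c > 0`, then `m` stays above `c e^{-(C + 1)(t - a)}`, where `C`
bounds the divergence of the drift. At a first contact point, the equation would force `m` to have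
been below this barrier before. -/
theorem IsClassicalSolution.barrier_lt (h : IsClassicalSolution ν T H uT m₀ u m) (hν : 0 < ν)
    (hH : IsC2Hamiltonian H) {a b c C : ℝ} (ha : 0 < a) (hb : b < T) (hc : 0 < c)
    (hC : ∀ t ∈ Icc a b, ∀ x, |divergence (drift H (m t) (u t)) x| ≤ C)
    (hac : ∀ x, c < m a x) {t : ℝ} (ht : t ∈ Icc a b) (x : Torus d) :
    c * Real.exp (-(C + 1) * (t - a)) < m t x := by
  set g : ℝ → ℝ := fun t => c * Real.exp (-(C + 1) * (t - a)) with hg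
  have hg_pos : ∀ t, 0 < g t := fun t => mul_pos hc (Real.exp_pos _)
  have hg' : ∀ t, HasDerivAt g (-(C + 1) * g t) t := fun t => by
    have := ((((hasDerivAt_id t).sub_const a).const_mul (-(C + 1))).exp).const_mul c
    refine this.congr_deriv ?_
    simp only [hg, id]
    ring
  have hgc : Continuous g := continuous_iff_continuousAt.2 fun t => (hg' t).continuousAt
  have hsub : Icc a b ⊆ Ioo 0 T := fun t ht => ⟨ha.trans_le ht.1, ht.2.trans_lt hb⟩
  have hmc : ContinuousOn (fun z : ℝ × Torus d => m z.1 z.2 - g z.1) (Icc a b ×ˢ univ) :=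
    (h.regular_m.continuousOn_Ioo.mono (prod_mono hsub Subset.rfl)).sub
      (hgc.comp continuous_fst).continuousOn
  by_contra! hcon
  -- the compact set of contacts with the barrier, and a contact `(t₀, x₀)` of least time
  set B : Set (ℝ × Torus d) :=
    (Icc a b ×ˢ univ) ∩ (fun z : ℝ × Torus d => m z.1 z.2 - g z.1) ⁻¹' Iic 0 with hB
  have hBc : IsCompact B :=
    (isCompact_Icc.prod isCompact_univ).of_isClosed_subset
      (hmc.preimage_isClosed_of_isClosed (isClosed_Icc.prod isClosed_univ) isClosed_Iic)
      inter_subset_left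
  obtain ⟨⟨t₀, x₀⟩, hz, hz_min⟩ := hBc.exists_isMinOn
    ⟨(t, x), ⟨ht, mem_univ _⟩, sub_nonpos.2 hcon⟩ continuous_fst.continuousOn
  have ht₀ : t₀ ∈ Icc a b := hz.1.1
  have hle : m t₀ x₀ ≤ g t₀ := sub_nonpos.1 hz.2
  have hbefore : ∀ s ∈ Ico a t₀, ∀ y, g s < m s y := by
    intro s hs y
    by_contra! hsy
    have : t₀ ≤ s := isMinOn_iff.1 hz_min (s, y)
      ⟨⟨⟨hs.1, hs.2.le.trans ht₀.2⟩, mem_univ _⟩, sub_nonpos.2 hsy⟩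
    exact absurd hs.2 this.not_gt
  have hat₀ : a < t₀ := by
    refine lt_of_le_of_ne ht₀.1 fun e => ?_
    have h1 : g t₀ = c := by simp [hg, ← e]
    rw [h1, ← e] at hle
    exact absurd (hac x₀) hle.not_gt
  have ht₀T : t₀ ∈ Ioo 0 T := hsub ht₀
  have hge : ∀ y, g t₀ ≤ m t₀ y := by
    intro y
    have hcont : ContinuousAt (fun s => m s y) t₀ :=
      (h.regular_m.hasDerivAt ht₀T y).continuousAt
    refine le_of_tendsto_of_tendsto (hgc.continuousAt.mono_left nhdsWithin_le_nhds)
      (hcont.mono_left (nhdsWithin_le_nhds (s := Iio t₀))) ?_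
    filter_upwards [Ico_mem_nhdsLT hat₀] with s hs
    exact (hbefore s hs y).le
  have heq : m t₀ x₀ = g t₀ := le_antisymm hle (hge x₀)
  have hmin : ∀ y, m t₀ x₀ ≤ m t₀ y := fun y => heq ▸ hge y
  -- the time derivative of `m - g` at the contact is `≤ 0`, but the equation makes it `≥ g t₀ > 0`
  have hder := deriv_nonpos_of_nonneg_left hat₀
    ((h.regular_m.hasDerivAt ht₀T x₀).sub (hg' t₀)) (by simp [heq])
    fun s hs => by simpa using (hbefore s hs x₀).le
  rw [h.deriv_density hH ht₀T, grad_eq_zero_of_min hmin, inner_zero_left, heq] at hder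
  have hlap := mul_nonneg hν.le
    (lap_nonneg_of_min (h.regular_m.space_contDiff t₀ ht₀T x₀) hmin)
  have hdiv := mul_le_mul_of_nonneg_left ((le_abs_self _).trans (hC t₀ ht₀ x₀)) (hg_pos t₀).le
  nlinarith [hg_pos t₀]

/-- The density stays positive. Near `t = 0`, where the drift is not controlled, this follows from
the positivity of `m₀` and continuity; afterwards the minimum principle applies. -/
theorem IsClassicalSolution.density_pos (h : IsClassicalSolution ν T H uT m₀ u m) (hν : 0 < ν)
    (hH : IsC2Hamiltonian H) (hm₀ : ∀ x, 0 < m₀ x) {t : ℝ} (ht : t ∈ Ioo 0 T) (x : Torus d) :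
    0 < m t x := by
  obtain ⟨x₁, -, hx₁⟩ := isCompact_univ.exists_isMinOn univ_nonempty m₀.continuous.continuousOn
  have hmin : ∀ y, m₀ x₁ ≤ m₀ y := fun y => isMinOn_iff.1 hx₁ y (mem_univ y)
  have hT : 0 < T := ht.1.trans ht.2
  have h0 : ContinuousWithinAt m (Icc 0 T) 0 :=
    h.regular_m.continuousOn_curve 0 ⟨le_rfl, hT.le⟩
  have hhalf : 0 < m₀ x₁ / 2 := half_pos (hm₀ x₁)
  obtain ⟨δ, hδ, hδ'⟩ := Metric.continuousWithinAt_iff.1 h0 _ hhalf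
  set a := min (δ / 2) t with ha_def
  have ha : 0 < a := lt_min (half_pos hδ) ht.1
  have hat : a ≤ t := min_le_right _ _
  have haδ : a < δ := (min_le_left _ _).trans_lt (half_lt_self hδ)
  have hma : ∀ y, m₀ x₁ / 2 < m a y := by
    intro y
    have h1 := hδ' (x := a) ⟨ha.le, hat.trans ht.2.le⟩
      (by rw [Real.dist_eq, sub_zero, abs_of_pos ha]; exact haδ)
    rw [h.initial] at h1
    have h2 := (ContinuousMap.dist_apply_le_dist y).trans_lt h1
    rw [Real.dist_eq] at h2
    have := (abs_lt.1 h2).1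
    linarith [hmin y]
  obtain ⟨C, hC⟩ := exists_bound_divergence_drift hH h.regular_u h.regular_m ha ht.2
  exact (mul_pos hhalf (Real.exp_pos _)).trans
    (h.barrier_lt hν hH ha ht.2 hhalf hC hma ⟨hat, le_rfl⟩ x)

theorem continuousOn_integral_of_curve {f : ℝ → C(Torus d, ℝ)} {s : Set ℝ}
    (hf : ContinuousOn f s) : ContinuousOn (fun t => ∫ x, f t x) s := by
  have e : (fun t => ∫ x, f t x) = fun t => integralPairing d ℝ 1 (f t) := by
    funext t
    rw [integralPairing_apply]
    simp
  rw [e]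
  exact (integralPairing d ℝ 1).continuous.comp_continuousOn hf

/-- The density keeps its mass. -/
theorem IsClassicalSolution.integral_density (h : IsClassicalSolution ν T H uT m₀ u m)
    (hH : IsC2Hamiltonian H) (hm₀ : ∫ x, m₀ x = 1) {t : ℝ} (ht : t ∈ Ioo 0 T) :
    ∫ x, m t x = 1 := by
  have hder : ∀ s ∈ Ioo 0 T, HasDerivAt (fun s => ∫ x, m s x) 0 s := by
    intro s hs
    have h1 := hasDerivAt_integral_torus h.regular_m.continuousOn_Ioo h.regular_m.time_continuous
      (fun t ht x => h.regular_m.hasDerivAt ht x) hs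
    have hd : ∀ x, ContDiff ℝ 1 (chart (fun y => m s y • drift H (m s) (u s) y) x) := fun x =>
      contDiff_chart_smul (h.regular_m.contDiff_one hs x)
        (contDiff_chart_drift hH (h.regular_u.space_contDiff s hs) x)
    have hm2 := h.regular_m.space_contDiff s hs
    have h2 : ∀ x, deriv (fun s => m s x) s = ν * lap (m s) x
        - divergence (fun y => m s y • drift H (m s) (u s) y) x := fun x => by
      have := h.fokkerPlanck s hs x
      have e : divergence (fun y => m s y • drift H (m s) (u s) y) x
        = divergence (fun y => m s y • dHdp H (m s) y (grad (u s) y)) x := rfl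
      rw [e]
      linarith
    simp_rw [h2] at h1
    rw [integral_sub (f := fun x => ν * lap (m s) x)
      (integrable_of_continuous (continuous_const.mul (continuous_lap hm2)))
      (integrable_of_continuous (continuous_divergence (hd 0))), integral_const_mul,
      integral_divergence hd] at h1
    simp_rw [fun x => lap_eq_divergence_grad (hm2 x)] at h1
    rw [integral_divergence fun x => contDiff_chart_grad (hm2 x)] at h1
    simpa using h1
  have hcont : ContinuousOn (fun s => ∫ x, m s x) (Icc 0 t) :=
    (continuousOn_integral_of_curve h.regular_m.continuousOn_curve).mono
      (Icc_subset_Icc_right ht.2.le)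
  obtain ⟨s, -, hs⟩ := exists_hasDerivAt_eq_slope _ _ ht.1 hcont fun s hs =>
    hder s ⟨hs.1, hs.2.trans ht.2⟩
  rw [h.initial, hm₀, eq_comm, div_eq_zero_iff] at hs
  rcases hs with hs | hs
  · linarith
  · linarith [ht.1]

theorem IsClassicalSolution.isProbDensity (h : IsClassicalSolution ν T H uT m₀ u m) (hν : 0 < ν)
    (hH : IsC2Hamiltonian H) (hdata : SmoothData uT m₀) {t : ℝ} (ht : t ∈ Ioo 0 T) :
    IsProbDensity (m t) :=
  ⟨fun x => (h.density_pos hν hH hdata.pos_m₀ ht x).le,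
    h.integral_density hH hdata.integral_m₀ ht⟩

/-! ### Saddle point monotonicity and the duality identity -/

/-- The monotonicity inequality for the derivatives of `𝓗`, which is convex in `m` and concave in
`p`: add the four tangent inequalities between `(m, p)`, `(m', p)`, `(m, p')` and `(m', p')`. -/
theorem saddle_monotone (hH : IsC2Hamiltonian H)
    (hpos : ∀ m : C(Torus d, ℝ), IsProbDensity m →
      ∀ p : C(Torus d, Vec d), ∀ μ : C(Torus d, ℝ), μ ≠ 0 → 0 < hamHessian H m p μ μ)
    (hconc : ∀ m : C(Torus d, ℝ), IsProbDensity m → ∀ x : Torus d,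
      StrictConcaveOn ℝ univ (fun p : Vec d => H m x p))
    {m m' : C(Torus d, ℝ)} (hm : IsProbDensity m) (hm' : IsProbDensity m')
    (hm_pos : ∀ x, 0 < m x) (p p' : C(Torus d, Vec d)) {r : ℝ}
    (hr : r = -fderiv ℝ (fun m₁ => hamFunctional H m₁ p) m (m - m')
      + fderiv ℝ (fun m₁ => hamFunctional H m₁ p') m' (m - m')
      + (∫ x, inner ℝ (p x - p' x) (m x • dHdp H m x (p x)))
      - ∫ x, inner ℝ (p x - p' x) (m' x • dHdp H m' x (p' x))) :
    r ≤ 0 ∧ (r = 0 → m = m' ∧ p = p') := by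
  have h3 := hamFunctional_le_tangent hH hconc hm' p' p
  have h4 := hamFunctional_le_tangent hH hconc hm p p'
  have h4' : p ≠ p' → _ := hamFunctional_lt_tangent hH hconc hm hm_pos (p := p) (q := p')
  have eneg : ∫ x, inner ℝ (p' x - p x) (m x • dHdp H m x (p x))
      = -∫ x, inner ℝ (p x - p' x) (m x • dHdp H m x (p x)) := by
    rw [← integral_neg]
    refine integral_congr_ae (Eventually.of_forall fun x => ?_)
    simp only
    rw [← inner_neg_left, neg_sub]
  rw [eneg] at h4 h4'
  by_cases hmm : m = m'
  · subst hmm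
    simp only [sub_self, map_zero, neg_zero, zero_add] at hr
    refine ⟨by linarith, fun h0 => ⟨rfl, ?_⟩⟩
    by_contra hpp
    have := h4' hpp
    linarith
  · have h1 := hamFunctional_tangent_lt hH hpos hm hm' hmm p
    have h2 := hamFunctional_tangent_lt hH hpos hm' hm (Ne.symm hmm) p'
    rw [← neg_sub m m', map_neg] at h1
    exact ⟨by linarith, fun h0 => absurd h0 (by linarith)⟩

variable {u' m' : ℝ → C(Torus d, ℝ)} {t : ℝ}

/-- The gradient of a `C¹` function as a continuous vector field. -/
noncomputable def gradField (u : C(Torus d, ℝ)) (hu : ∀ x, ContDiff ℝ 1 (chart u x)) :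
    C(Torus d, Vec d) :=
  ⟨grad u, continuous_grad (hu 0)⟩

/-- The weak form of the Hamilton-Jacobi-Bellman equation. -/
theorem IsClassicalSolution.integral_deriv_value_mul (h : IsClassicalSolution ν T H uT m₀ u m)
    (hHm : HasBoundedMDerivative H) (hH : IsC2Hamiltonian H) (ht : t ∈ Ioo 0 T)
    (μ : C(Torus d, ℝ)) (hμ : ∀ x, ContDiff ℝ 1 (chart μ x)) :
    ∫ x, deriv (fun s => u s x) t * μ x
      = ν * (∫ x, inner ℝ (grad μ x) (grad (u t) x))
        - fderiv ℝ (fun m₁ => hamFunctional H m₁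
            (gradField (u t) (h.regular_u.contDiff_one ht))) (m t) μ := by
  set p := gradField (u t) (h.regular_u.contDiff_one ht) with hp
  have hu2 := h.regular_u.space_contDiff t ht
  have hi1 : Integrable fun x => μ x * lap (u t) x :=
    integrable_of_continuous (μ.continuous.mul (continuous_lap hu2))
  have hi2 : Integrable fun x => (H (m t) x (p x) + nonlocal H (m t) p x) * μ x := by
    simp_rw [add_mul]
    exact (integrable_of_continuous ((continuous_hamiltonian hH (m t) p).mul μ.continuous)).add
      (integrable_Lp_mul _ μ)
  have e : (fun x => deriv (fun s => u s x) t * μ x) =ᵐ[volume] fun x =>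
      -ν * (μ x * lap (u t) x) - (H (m t) x (p x) + nonlocal H (m t) p x) * μ x := by
    filter_upwards [h.hjb t ht] with x hx
    have hx' : deriv (fun s => u s x) t + ν * lap (u t) x + H (m t) x (p x)
      + nonlocal H (m t) p x = 0 := hx
    linear_combination μ x * hx'
  rw [integral_congr_ae e, integral_sub (hi1.const_mul _) hi2, integral_const_mul,
    integral_mul_lap hμ hu2, fderiv_hamFunctional_apply hHm hH]
  ring

/-- The weak form of the Fokker-Planck equation. -/
theorem IsClassicalSolution.integral_mul_deriv_density (h : IsClassicalSolution ν T H uT m₀ u m)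
    (hH : IsC2Hamiltonian H) (ht : t ∈ Ioo 0 T)
    (w : C(Torus d, ℝ)) (hw : ∀ x, ContDiff ℝ 1 (chart w x)) :
    ∫ x, w x * deriv (fun s => m s x) t
      = -(ν * ∫ x, inner ℝ (grad w x) (grad (m t) x))
        + ∫ x, inner ℝ (grad w x) (m t x • drift H (m t) (u t) x) := by
  have hm2 := h.regular_m.space_contDiff t ht
  have hV : ∀ x, ContDiff ℝ 1 (chart (fun y => m t y • drift H (m t) (u t) y) x) := fun x =>
    contDiff_chart_smul (h.regular_m.contDiff_one ht x)
      (contDiff_chart_drift hH (h.regular_u.space_contDiff t ht) x)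
  have hi1 : Integrable fun x => w x * lap (m t) x :=
    integrable_of_continuous (w.continuous.mul (continuous_lap hm2))
  have hi2 : Integrable fun x =>
      w x * divergence (fun y => m t y • drift H (m t) (u t) y) x :=
    integrable_of_continuous (w.continuous.mul (continuous_divergence (hV 0)))
  have e : (fun x => w x * deriv (fun s => m s x) t) = fun x =>
      ν * (w x * lap (m t) x) - w x * divergence (fun y => m t y • drift H (m t) (u t) y) x := by
    funext x
    have hx : deriv (fun s => m s x) t - ν * lap (m t) x
      + divergence (fun y => m t y • drift H (m t) (u t) y) x = 0 := h.fokkerPlanck t ht x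
    linear_combination w x * hx
  rw [e, integral_sub (hi1.const_mul _) hi2, integral_const_mul, integral_mul_lap hw hm2,
    integral_mul_divergence hw hV]
  ring

/-- The duality identity: the viscous terms cancel in the derivative of `∫ (u - u') (m - m')`. -/
theorem hasDerivAt_duality (hHm : HasBoundedMDerivative H) (hH : IsC2Hamiltonian H)
    (h : IsClassicalSolution ν T H uT m₀ u m) (h' : IsClassicalSolution ν T H uT m₀ u' m')
    (ht : t ∈ Ioo 0 T) :
    HasDerivAt (fun s => ∫ x, (u s x - u' s x) * (m s x - m' s x))
      (-fderiv ℝ (fun m₁ => hamFunctional H m₁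
            (gradField (u t) (h.regular_u.contDiff_one ht))) (m t) (m t - m' t)
        + fderiv ℝ (fun m₁ => hamFunctional H m₁
            (gradField (u' t) (h'.regular_u.contDiff_one ht))) (m' t) (m t - m' t)
        + (∫ x, inner ℝ (grad (u t) x - grad (u' t) x) (m t x • drift H (m t) (u t) x))
        - ∫ x, inner ℝ (grad (u t) x - grad (u' t) x) (m' t x • drift H (m' t) (u' t) x)) t := by
  have hu := h.regular_u
  have hu' := h'.regular_u
  have hm := h.regular_m
  have hm' := h'.regular_m
  have hder := hasDerivAt_integral_torus
    (f' := fun t x => (deriv (fun s => u s x) t - deriv (fun s => u' s x) t) * (m t x - m' t x)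
      + (u t x - u' t x) * (deriv (fun s => m s x) t - deriv (fun s => m' s x) t))
    ((hu.continuousOn_Ioo.sub hu'.continuousOn_Ioo).mul
      (hm.continuousOn_Ioo.sub hm'.continuousOn_Ioo))
    (((hu.time_continuous.sub hu'.time_continuous).mul
      (hm.continuousOn_Ioo.sub hm'.continuousOn_Ioo)).add
      ((hu.continuousOn_Ioo.sub hu'.continuousOn_Ioo).mul
      (hm.time_continuous.sub hm'.time_continuous)))
    (fun t ht x => ((hu.hasDerivAt ht x).sub (hu'.hasDerivAt ht x)).mul
      ((hm.hasDerivAt ht x).sub (hm'.hasDerivAt ht x))) ht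
  refine hder.congr_deriv ?_
  set w : C(Torus d, ℝ) := u t - u' t with hw
  set μ : C(Torus d, ℝ) := m t - m' t with hμ
  have hw1 : ∀ x, ContDiff ℝ 1 (chart w x) := fun x =>
    (hu.contDiff_one ht x).sub (hu'.contDiff_one ht x)
  have hμ1 : ∀ x, ContDiff ℝ 1 (chart μ x) := fun x =>
    (hm.contDiff_one ht x).sub (hm'.contDiff_one ht x)
  have hgw : ∀ x, grad w x = grad (u t) x - grad (u' t) x := fun x =>
    grad_sub ((hu.contDiff_one ht x).differentiable one_ne_zero 0)
      ((hu'.contDiff_one ht x).differentiable one_ne_zero 0)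
  have hgμ : ∀ x, grad μ x = grad (m t) x - grad (m' t) x := fun x =>
    grad_sub ((hm.contDiff_one ht x).differentiable one_ne_zero 0)
      ((hm'.contDiff_one ht x).differentiable one_ne_zero 0)
  have split : ∫ x, ((deriv (fun s => u s x) t - deriv (fun s => u' s x) t) * (m t x - m' t x)
      + (u t x - u' t x) * (deriv (fun s => m s x) t - deriv (fun s => m' s x) t))
      = (∫ x, deriv (fun s => u s x) t * μ x) - (∫ x, deriv (fun s => u' s x) t * μ x)
        + ((∫ x, w x * deriv (fun s => m s x) t) - ∫ x, w x * deriv (fun s => m' s x) t) := by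
    have i1 : Integrable fun x => deriv (fun s => u s x) t * μ x :=
      integrable_of_continuous ((hu.continuous_deriv ht).mul μ.continuous)
    have i2 : Integrable fun x => deriv (fun s => u' s x) t * μ x :=
      integrable_of_continuous ((hu'.continuous_deriv ht).mul μ.continuous)
    have i3 : Integrable fun x => w x * deriv (fun s => m s x) t :=
      integrable_of_continuous (w.continuous.mul (hm.continuous_deriv ht))
    have i4 : Integrable fun x => w x * deriv (fun s => m' s x) t :=
      integrable_of_continuous (w.continuous.mul (hm'.continuous_deriv ht))
    rw [← integral_sub i1 i2, ← integral_sub i3 i4]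
    refine Eq.trans ?_ (integral_add (i1.sub i2) (i3.sub i4))
    refine integral_congr_ae (Eventually.of_forall fun x => ?_)
    simp only [hw, hμ, ContinuousMap.sub_apply]
    ring
  have visc : (∫ x, inner ℝ (grad μ x) (grad (u t) x)) - (∫ x, inner ℝ (grad μ x) (grad (u' t) x))
      = (∫ x, inner ℝ (grad w x) (grad (m t) x)) - ∫ x, inner ℝ (grad w x) (grad (m' t) x) := by
    have ci : ∀ {f g : C(Torus d, ℝ)}, (∀ x, ContDiff ℝ 1 (chart f x)) →
        (∀ x, ContDiff ℝ 1 (chart g x)) → Integrable fun x => inner ℝ (grad f x) (grad g x) :=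
      fun hf hg =>
        integrable_of_continuous ((continuous_grad (hf 0)).inner (continuous_grad (hg 0)))
    rw [← integral_sub (ci hμ1 (hu.contDiff_one ht)) (ci hμ1 (hu'.contDiff_one ht)),
      ← integral_sub (ci hw1 (hm.contDiff_one ht)) (ci hw1 (hm'.contDiff_one ht))]
    refine integral_congr_ae (Eventually.of_forall fun x => ?_)
    simp only [← inner_sub_right]
    rw [← hgw, ← hgμ, real_inner_comm]
  rw [split, h.integral_deriv_value_mul hHm hH ht μ hμ1,
    h'.integral_deriv_value_mul hHm hH ht μ hμ1, h.integral_mul_deriv_density hH ht w hw1,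
    h'.integral_mul_deriv_density hH ht w hw1]
  simp_rw [← hgw]
  linear_combination ν * visc

/-- The duality identity and the monotonicity of the derivatives of `𝓗` determine the density and
the gradient of the value function: `∫ (u - u') (m - m')` is nonincreasing and vanishes at both
ends of `[0, T]`. -/
theorem density_and_grad_unique (hν : 0 < ν) (hdata : SmoothData uT m₀)
    (hHm : HasBoundedMDerivative H) (hH : IsC2Hamiltonian H)
    (hpos : ∀ m : C(Torus d, ℝ), IsProbDensity m →
      ∀ p : C(Torus d, Vec d), ∀ μ : C(Torus d, ℝ), μ ≠ 0 → 0 < hamHessian H m p μ μ)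
    (hconc : ∀ m : C(Torus d, ℝ), IsProbDensity m → ∀ x : Torus d,
      StrictConcaveOn ℝ univ (fun p : Vec d => H m x p))
    (h : IsClassicalSolution ν T H uT m₀ u m) (h' : IsClassicalSolution ν T H uT m₀ u' m')
    (ht : t ∈ Ioo 0 T) : m t = m' t ∧ (grad (u t) : Torus d → Vec d) = grad (u' t) := by
  set φ : ℝ → ℝ := fun s => ∫ x, (u s x - u' s x) * (m s x - m' s x) with hφ
  have hT : 0 < T := ht.1.trans ht.2
  have key : ∀ s ∈ Ioo 0 T, ∃ r, HasDerivAt φ r s ∧ r ≤ 0 ∧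
      (r = 0 → m s = m' s ∧ (grad (u s) : Torus d → Vec d) = grad (u' s)) := by
    intro s hs
    obtain ⟨h1, h2⟩ := saddle_monotone hH hpos hconc (h.isProbDensity hν hH hdata hs)
      (h'.isProbDensity hν hH hdata hs) (h.density_pos hν hH hdata.pos_m₀ hs)
      (gradField (u s) (h.regular_u.contDiff_one hs))
      (gradField (u' s) (h'.regular_u.contDiff_one hs)) rfl
    exact ⟨_, hasDerivAt_duality hHm hH h h' hs, h1, fun h0 =>
      ⟨(h2 h0).1, congrArg (fun f : C(Torus d, Vec d) => (f : Torus d → Vec d)) (h2 h0).2⟩⟩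
  have hcont : ContinuousOn φ (Icc 0 T) :=
    continuousOn_integral_of_curve (f := fun s => (u s - u' s) * (m s - m' s))
      ((h.regular_u.continuousOn_curve.sub h'.regular_u.continuousOn_curve).mul
        (h.regular_m.continuousOn_curve.sub h'.regular_m.continuousOn_curve))
  have hanti : AntitoneOn φ (Icc 0 T) := by
    refine antitoneOn_of_deriv_nonpos (convex_Icc 0 T) hcont ?_ ?_
    · intro s hs
      rw [interior_Icc] at hs
      obtain ⟨r, hr, -⟩ := key s hs
      exact hr.differentiableAt.differentiableWithinAt
    · intro s hs
      rw [interior_Icc] at hs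
      obtain ⟨r, hr, hr0, -⟩ := key s hs
      rwa [hr.deriv]
  have h0 : φ 0 = 0 := by simp [hφ, h.initial, h'.initial]
  have h1 : φ T = 0 := by simp [hφ, h.terminal, h'.terminal]
  have hzero : ∀ s ∈ Icc 0 T, φ s = 0 := fun s hs =>
    le_antisymm (h0 ▸ hanti ⟨le_rfl, hT.le⟩ hs hs.1) (h1 ▸ hanti hs ⟨hT.le, le_rfl⟩ hs.2)
  obtain ⟨r, hr, -, hr0⟩ := key t ht
  refine hr0 (hr.unique ((hasDerivAt_const t (0 : ℝ)).congr_of_eventuallyEq ?_))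
  filter_upwards [isOpen_Ioo.mem_nhds ht] with s hs
  exact hzero s (Ioo_subset_Icc_self hs)

/-- If the densities and the gradients of the value functions agree at time `t`, then the
Hamilton-Jacobi-Bellman equation makes the time derivatives agree; the almost everywhere identity
extends to all points by continuity. -/
theorem deriv_value_unique (h : IsClassicalSolution ν T H uT m₀ u m)
    (h' : IsClassicalSolution ν T H uT m₀ u' m') (ht : t ∈ Ioo 0 T) (hm : m t = m' t)
    (hg : (grad (u t) : Torus d → Vec d) = grad (u' t)) (x : Torus d) :
    deriv (fun s => u s x) t = deriv (fun s => u' s x) t := by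
  have hlap : ∀ y, lap (u t) y = lap (u' t) y := fun y => by
    rw [lap_eq_divergence_grad (h.regular_u.space_contDiff t ht y),
      lap_eq_divergence_grad (h'.regular_u.space_contDiff t ht y), hg]
  refine congrFun ((Continuous.ae_eq_iff_eq (volume : Measure (Torus d))
    (h.regular_u.continuous_deriv ht) (h'.regular_u.continuous_deriv ht)).1 ?_) x
  filter_upwards [h.hjb t ht, h'.hjb t ht] with y hy hy'
  rw [hlap, hm, hg] at hy
  linarith

end MFTC

theorem mainTheorem3 {d : ℕ} (ν T : ℝ) (hν : 0 < ν) (hT : 0 < T)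
    (H : C(MFTC.Torus d, ℝ) → MFTC.Torus d → MFTC.Vec d → ℝ)
    (uT m₀ : C(MFTC.Torus d, ℝ)) (hdata : MFTC.SmoothData uT m₀)
    (hHm : MFTC.HasBoundedMDerivative H) (hH : MFTC.IsC2Hamiltonian H)
    (hpos : ∀ m : C(MFTC.Torus d, ℝ), MFTC.IsProbDensity m →
      ∀ p : C(MFTC.Torus d, MFTC.Vec d), ∀ μ : C(MFTC.Torus d, ℝ), μ ≠ 0 →
        0 < MFTC.hamHessian H m p μ μ)
    (hconc : ∀ m : C(MFTC.Torus d, ℝ), MFTC.IsProbDensity m → ∀ x : MFTC.Torus d,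
      StrictConcaveOn ℝ Set.univ (fun p : MFTC.Vec d => H m x p))
    (u m u' m' : ℝ → C(MFTC.Torus d, ℝ))
    (h : MFTC.IsClassicalSolution ν T H uT m₀ u m)
    (h' : MFTC.IsClassicalSolution ν T H uT m₀ u' m') :
    ∀ t ∈ Set.Icc 0 T, u t = u' t ∧ m t = m' t := by
  have key := fun (t : ℝ) (ht : t ∈ Ioo 0 T) =>
    MFTC.density_and_grad_unique hν hdata hHm hH hpos hconc h h' ht
  have hclosure : Icc 0 T ⊆ closure (Ioo 0 T) := (closure_Ioo hT.ne).symm.subset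
  have hm : EqOn m m' (Icc 0 T) :=
    EqOn.of_subset_closure (fun t ht => (key t ht).1) h.regular_m.continuousOn_curve
      h'.regular_m.continuousOn_curve Ioo_subset_Icc_self hclosure
  have hu : EqOn u u' (Ioo 0 T) := by
    intro t ht
    ext x
    have hsub : Icc t T ⊆ Icc 0 T := Icc_subset_Icc_left ht.1.le
    have hcont : ContinuousOn (fun s => u s x - u' s x) (Icc t T) :=
      (((continuous_eval_const x).comp_continuousOn
        h.regular_u.continuousOn_curve).sub ((continuous_eval_const x).comp_continuousOn
        h'.regular_u.continuousOn_curve)).mono hsub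
    obtain ⟨s, hs, hs'⟩ := exists_hasDerivAt_eq_slope _ _ ht.2 hcont fun s hs =>
      (h.regular_u.hasDerivAt ⟨ht.1.trans hs.1, hs.2⟩ x).sub
        (h'.regular_u.hasDerivAt ⟨ht.1.trans hs.1, hs.2⟩ x)
    have hsT : s ∈ Ioo 0 T := ⟨ht.1.trans hs.1, hs.2⟩
    rw [MFTC.deriv_value_unique h h' hsT (key s hsT).1 (key s hsT).2 x, sub_self, h.terminal,
      h'.terminal, sub_self, eq_comm, div_eq_zero_iff] at hs'
    rcases hs' with hs' | hs'
    · linarith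
    · linarith [ht.2]
  exact fun t ht => ⟨EqOn.of_subset_closure hu h.regular_u.continuousOn_curve
    h'.regular_u.continuousOn_curve Ioo_subset_Icc_self hclosure ht, hm ht⟩
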